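/- Let $\mathbb{D}=\{w\in\mathbb{C}:|w|<1\}$ and let $1\le p<\infty$. For a holomorphic function $f:\mathbb{D}\to\mathbb{C}$ and $0<r<1$ put $$M_p(r,f)=\Big(\int_0^{2\pi}|f(re^{i\theta})|^p\,\frac{d\theta}{2\pi}\Big)^{1/p},$$ and let $H^p(\mathbb{D})$ be the set of all holomorphic $f:\mathbb{D}\to\mathbb{C}$ for which $\lim_{r\to1^-}M_p(r,f)$ exists and is finite. For $f\in H^p(\mathbb{D})$ the radial limit $f^*(e^{i\theta})=\lim_{r\to1^-}f(re^{i\theta})$ exists for almost every $\theta\in(0,2\pi]$, and $f^*$ belongs to $L^p$ of the unit circle $\mathbb{T}$ with respect to $d\theta/2\pi$; put $\|f\|_p=\|f^*\|_{L^p(\mathbb{T})}$. Then $H^p(\mathbb{D})$ with the norm $\|\cdot\|_p$ is a Banach space of analytic functions on $\mathbb{D}$. That is, $H^p(\mathbb{D})$ is a complex vector space of holomorphic functions on $\mathbb{D}$, $\|\cdot\|_p$ is a norm on it for which it is complete, and: 1. the polynomials $P\in\mathbb{C}[z]$, restricted to $\mathbb{D}$, belong to $H^p(\mathbb{D})$ and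 form a dense subset of it; 2. for each $w\in\mathbb{D}$ there is a constant $C$ with $|f(w)|\le C\|f\|_p$ for all $f\in H^p(\mathbb{D})$; 3. if $f\in H^p(\mathbb{D})$, then the function $z\mapsto zf(z)$ belongs to $H^p(\mathbb{D})$. -/

import Mathlib

open Filter Topology MeasureTheory

noncomputable section

/-- Extension by `0` to `ℂ` of a function `f : Ω → ℂ`. Only its values on `Ω` are ever relevant. -/
def extendZero {Ω : Set ℂ} (f : Ω → ℂ) : ℂ → ℂ :=
  Function.extend Subtype.val f 0

/-- `Hol(Ω)`: the `ℂ`-valued holomorphic functions on `Ω`. -/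
def Hol (Ω : Set ℂ) : Set (Ω → ℂ) :=
  {f | DifferentiableOn ℂ (extendZero f) Ω}

/-- The restriction to `Ω` of a polynomial in one complex variable. -/
def polyFun (Ω : Set ℂ) (P : Polynomial ℂ) : Ω → ℂ :=
  fun w => P.eval (w : ℂ)

/-- The shift `f ↦ z f`, on arbitrary functions on `Ω`. -/
def shiftFun {Ω : Set ℂ} (f : Ω → ℂ) : Ω → ℂ :=
  fun w => (w : ℂ) * f w

/-- A linear space `X` of functions on the open set `Ω ⊆ ℂ`, with the norm `N`, is a *Banach space
of analytic functions* on `Ω`. -/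
structure IsBanachSpaceOfAnalyticFunctions
    (Ω : Set ℂ) (X : Submodule ℂ (Ω → ℂ)) (N : X → ℝ) : Prop where
  isOpen : IsOpen Ω
  /-- The elements of `X` are holomorphic. -/
  subset_hol : (X : Set (Ω → ℂ)) ⊆ Hol Ω
  /-- `N` is a norm on the complex vector space `X`. -/
  core : @NormedSpace.Core ℂ X _ _ _ ⟨N⟩
  /-- `X` is complete: every sequence that is Cauchy for `N` converges in `X` for `N`. -/
  complete : ∀ u : ℕ → X,
    (∀ ε > 0, ∃ n₀, ∀ m ≥ n₀, ∀ n ≥ n₀, N (u m - u n) < ε) →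
      ∃ f : X, Tendsto (fun n => N (u n - f)) atTop (𝓝 0)
  /-- Polynomials belong to `X`. -/
  poly_mem : ∀ P : Polynomial ℂ, polyFun Ω P ∈ X
  /-- Polynomials are dense in `X` for `N`. -/
  poly_dense : ∀ f : X, ∀ ε > 0, ∃ P : Polynomial ℂ, N (f - ⟨polyFun Ω P, poly_mem P⟩) < ε
  /-- Each evaluation functional `f ↦ f w` is bounded. -/
  eval_bounded : ∀ w : Ω, ∃ C : ℝ, ∀ f : X, ‖(f : Ω → ℂ) w‖ ≤ C * N f
  /-- The shift operator `f ↦ z f` is well defined on `X`. -/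
  shift_mem : ∀ f ∈ X, shiftFun f ∈ X

/-- The open unit disk `𝔻`. -/
def unitDisk : Set ℂ := Metric.ball 0 1

/-- The integral mean `M_p(r, f) = (∫₀^{2π} |f(r e^{iθ})|^p dθ / 2π)^{1/p}`. -/
def integralMean (p r : ℝ) (f : unitDisk → ℂ) : ℝ :=
  ((2 * Real.pi)⁻¹ *
    ∫ θ in (0 : ℝ)..(2 * Real.pi), ‖extendZero f (circleMap 0 r θ)‖ ^ p) ^ (1 / p)

/-- The Hardy space `H^p(𝔻)`: the holomorphic `f` on `𝔻` for which `M_p(r, f)` has a finite limit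
as `r → 1⁻`. -/
def hardySpace (p : ℝ) : Set (unitDisk → ℂ) :=
  {f | f ∈ Hol unitDisk ∧ ∃ L : ℝ, Tendsto (fun r => integralMean p r f) (𝓝[<] 1) (𝓝 L)}

/-- The boundary function `f^*(ζ) = lim_{r → 1⁻} f(r ζ)`, for `ζ` on the unit circle at which this
radial limit exists. -/
def boundaryFun (f : unitDisk → ℂ) (ζ : ℂ) : ℂ :=
  limUnder (𝓝[<] (1 : ℝ)) fun r : ℝ => extendZero f (r * ζ)

/-- The normalized Lebesgue measure `dθ / 2π` on `(0, 2π]`, which parametrizes the unit circle by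
`θ ↦ e^{iθ} = circleMap 0 1 θ`. -/
def circleMeasure : Measure ℝ :=
  (ENNReal.ofReal (2 * Real.pi))⁻¹ • volume.restrict (Set.Ioc 0 (2 * Real.pi))

/-- The norm `‖f‖_p = ‖f^*‖_{L^p(𝕋)}`. -/
def hardyNorm (p : ℝ) (f : unitDisk → ℂ) : ℝ :=
  (eLpNorm (fun θ : ℝ => boundaryFun f (circleMap 0 1 θ)) (ENNReal.ofReal p) circleMeasure).toReal

end

noncomputable section

/-! ### The normalized measure on the circle -/

/-! The core fact is that, for `F` holomorphic on the disk with bounded means of order `p`, the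
dilates `F (r ·)` converge in `L^p` of the circle to the radial limit function
(`HasBoundedMeans.tendsto_eLpNorm_sub`). Hence `‖f‖_p` is the limit, and by monotonicity an upper
bound, of the means. Cauchy's formula then bounds evaluations, Fatou's lemma on each circle gives
completeness, and Taylor polynomials of a dilate give density.

Questions of order `p` are reduced to `L²`, where Parseval applies, without discussing zeros or
Blaschke products. On the circle, a slightly raised `log |G|` is approximated by the real part of a
polynomial `Q`; the maximum principle for `G exp (-Q)` gives `|G| ≤ |exp Q|` on the disk
(`exists_exp_polynomial_majorant`). Since `exp Q` has no zeros, its power `exp ((p/2) Q)` is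
holomorphic, with `L²` norm controlled by the `L^p` norm of `G`. This yields monotone means
(`circleNorm_mono`). Applied to dilates, with a limit of Taylor coefficients along an ultrafilter,
it yields `|F| ≤ |h|^(2/p)` with `h` in `H²` (`exists_l2_majorant`) and, for `p = 1`, a product of
two `H²` functions (`exists_l2_factorization`).

A primitive of an `H²` function has boundary values of bounded variation, hence differentiable
almost everywhere; Fatou's theorem (`exists_tendsto_deriv_of_differentiableAt`) turns this into
radial limits of the function itself, and the factorization carries them to `H^p`. Dilates of an
`H²` function are uniformly integrable, the majorant carries this to `H^p`, and Vitali's theorem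
gives the convergence in `L^p`. -/

instance isProbabilityMeasure_circleMeasure : IsProbabilityMeasure circleMeasure := by
  refine ⟨?_⟩
  have h : (0 : ℝ) < 2 * Real.pi := Real.two_pi_pos
  simp only [circleMeasure, Measure.smul_apply, Measure.restrict_apply MeasurableSet.univ,
    Set.univ_inter, Real.volume_Ioc, sub_zero, smul_eq_mul]
  exact ENNReal.inv_mul_cancel (by simpa using h) ENNReal.ofReal_ne_top

theorem integral_circleMeasure {E : Type*} [NormedAddCommGroup E] [NormedSpace ℝ E] (f : ℝ → E) :
    ∫ θ, f θ ∂circleMeasure = (2 * Real.pi)⁻¹ • ∫ θ in (0 : ℝ)..(2 * Real.pi), f θ := by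
  rw [circleMeasure, integral_smul_measure, intervalIntegral.integral_of_le Real.two_pi_pos.le,
    ENNReal.toReal_inv, ENNReal.toReal_ofReal Real.two_pi_pos.le]

theorem circleMeasure_absolutelyContinuous :
    circleMeasure ≪ volume.restrict (Set.Ioc 0 (2 * Real.pi)) :=
  Measure.smul_absolutelyContinuous

theorem memLp_circleMeasure_of_continuous {E : Type*} [NormedAddCommGroup E] {f : ℝ → E}
    [SecondCountableTopologyEither ℝ E]
    (hf : Continuous f) (p : ENNReal) : MemLp f p circleMeasure := by
  obtain ⟨C, hC⟩ := (isCompact_Icc (a := (0 : ℝ)) (b := 2 * Real.pi)).exists_bound_of_continuousOn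
    hf.continuousOn
  refine MemLp.of_bound hf.aestronglyMeasurable C ?_
  refine circleMeasure_absolutelyContinuous.ae_le ?_
  filter_upwards [ae_restrict_mem measurableSet_Ioc] with θ hθ
  exact hC θ (Set.Ioc_subset_Icc_self hθ)

theorem norm_circleMap_zero_one (θ : ℝ) : ‖circleMap 0 1 θ‖ = 1 := by simp

theorem ofReal_mul_circleMap (r s θ : ℝ) : (r : ℂ) * circleMap 0 s θ = circleMap 0 (r * s) θ := by
  simp [circleMap, mul_assoc]

/-! ### Parseval's identity for absolutely convergent power series on the circle -/

/-- The sum of the power series with coefficients `a`. -/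
def powSum (a : ℕ → ℂ) (z : ℂ) : ℂ := ∑' n, a n * z ^ n

theorem norm_coeff_mul_pow_le {a : ℕ → ℂ} {z : ℂ} (hz : ‖z‖ ≤ 1) (n : ℕ) :
    ‖a n * z ^ n‖ ≤ ‖a n‖ := by
  rw [norm_mul, norm_pow]
  exact mul_le_of_le_one_right (norm_nonneg _) (pow_le_one₀ (norm_nonneg _) hz)

theorem hasSum_powSum {a : ℕ → ℂ} (ha : Summable fun n => ‖a n‖) {z : ℂ} (hz : ‖z‖ ≤ 1) :
    HasSum (fun n => a n * z ^ n) (powSum a z) :=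
  (Summable.of_norm_bounded ha fun n => norm_coeff_mul_pow_le hz n).hasSum

theorem continuousOn_powSum {a : ℕ → ℂ} (ha : Summable fun n => ‖a n‖) :
    ContinuousOn (powSum a) (Metric.closedBall 0 1) := by
  refine continuousOn_tsum (fun n => by fun_prop) ha fun n z hz => ?_
  exact norm_coeff_mul_pow_le (by simpa using hz) n

theorem continuous_powSum_circleMap {a : ℕ → ℂ} (ha : Summable fun n => ‖a n‖) :
    Continuous fun θ => powSum a (circleMap 0 1 θ) :=
  (continuousOn_powSum ha).comp_continuous (continuous_circleMap 0 1) fun θ => by simp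

theorem integral_norm_sq_sum_circleMap (a : ℕ → ℂ) (N : ℕ) :
    ∫ θ, ‖∑ n ∈ Finset.range N, a n * circleMap 0 1 θ ^ n‖ ^ 2 ∂circleMeasure =
      ∑ n ∈ Finset.range N, ‖a n‖ ^ 2 := by
  have key := Polynomial.sum_sq_norm_coeff_eq_circleAverage
    (∑ n ∈ Finset.range N, Polynomial.C (a n) * Polynomial.X ^ n)
  have hc : ∀ i, (∑ n ∈ Finset.range N, Polynomial.C (a n) * Polynomial.X ^ n).coeff i =
      if i < N then a i else 0 := by
    intro i
    simp [Polynomial.coeff_C_mul, Polynomial.coeff_X_pow]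
  simp only [hc] at key
  rw [integral_circleMeasure]
  simp only [Real.circleAverage, Polynomial.eval_finsetSum, Polynomial.eval_mul,
    Polynomial.eval_C, Polynomial.eval_pow, Polynomial.eval_X] at key
  rw [← key]
  have hs : (∑ n ∈ Finset.range N, Polynomial.C (a n) * Polynomial.X ^ n).support ⊆
      Finset.range N := by
    intro i hi
    rw [Polynomial.mem_support_iff, hc] at hi
    simpa using fun h => hi (if_neg h)
  rw [Finset.sum_subset hs]
  · refine Finset.sum_congr rfl fun i hi => ?_
    rw [if_pos (Finset.mem_range.mp hi)]
  · intro i _ hi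
    rw [Polynomial.mem_support_iff, hc, not_not] at hi
    simp [hi]

theorem summable_sq_of_summable_norm {a : ℕ → ℂ} (ha : Summable fun n => ‖a n‖) :
    Summable fun n => ‖a n‖ ^ 2 := by
  refine Summable.of_nonneg_of_le (fun n => by positivity) (fun n => ?_)
    (ha.mul_left (∑' n, ‖a n‖))
  rw [sq]
  exact mul_le_mul_of_nonneg_right (ha.le_tsum n fun _ _ => norm_nonneg _) (norm_nonneg _)

theorem integral_norm_sq_powSum {a : ℕ → ℂ} (ha : Summable fun n => ‖a n‖) :
    ∫ θ, ‖powSum a (circleMap 0 1 θ)‖ ^ 2 ∂circleMeasure = ∑' n, ‖a n‖ ^ 2 := by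
  have h1 : Tendsto (fun N => ∫ θ, ‖∑ n ∈ Finset.range N, a n * circleMap 0 1 θ ^ n‖ ^ 2
      ∂circleMeasure) atTop (𝓝 (∫ θ, ‖powSum a (circleMap 0 1 θ)‖ ^ 2 ∂circleMeasure)) := by
    -- All partial sums are bounded on the circle by the sum of the `‖a n‖`.
    refine tendsto_integral_of_dominated_convergence (fun _ => (∑' n, ‖a n‖) ^ 2)
      (fun N => ?_) (integrable_const _) (fun N => ?_) ?_
    · exact Continuous.aestronglyMeasurable (by fun_prop)
    · refine Eventually.of_forall fun θ => ?_
      rw [Real.norm_of_nonneg (by positivity)]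
      gcongr
      refine (norm_sum_le _ _).trans (le_trans (Finset.sum_le_sum fun n _ =>
        norm_coeff_mul_pow_le (norm_circleMap_zero_one θ).le n) ?_)
      exact ha.sum_le_tsum _ fun _ _ => norm_nonneg _
    · exact Eventually.of_forall fun θ =>
        ((hasSum_powSum ha (norm_circleMap_zero_one θ).le).tendsto_sum_nat.norm.pow 2)
  simp only [integral_norm_sq_sum_circleMap] at h1
  exact tendsto_nhds_unique h1 (summable_sq_of_summable_norm ha).hasSum.tendsto_sum_nat

theorem eLpNorm_two_eq_of_continuous {f : ℝ → ℂ} (hf : Continuous f) :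
    eLpNorm f 2 circleMeasure = ENNReal.ofReal (√(∫ θ, ‖f θ‖ ^ 2 ∂circleMeasure)) := by
  rw [(memLp_circleMeasure_of_continuous hf 2).eLpNorm_eq_integral_rpow_norm (by simp) (by simp)]
  simp [Real.sqrt_eq_rpow]

theorem eLpNorm_powSum {a : ℕ → ℂ} (ha : Summable fun n => ‖a n‖) :
    eLpNorm (fun θ => powSum a (circleMap 0 1 θ)) 2 circleMeasure =
      ENNReal.ofReal (√(∑' n, ‖a n‖ ^ 2)) := by
  rw [eLpNorm_two_eq_of_continuous (continuous_powSum_circleMap ha), integral_norm_sq_powSum ha]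

/-- The coefficients of the dilate `z ↦ f (r z)`. -/
def dilate (r : ℝ) (a : ℕ → ℂ) (n : ℕ) : ℂ := a n * (r : ℂ) ^ n

theorem powSum_dilate (r : ℝ) (a : ℕ → ℂ) (z : ℂ) : powSum (dilate r a) z = powSum a (r * z) := by
  simp [powSum, dilate, mul_pow, mul_assoc]

theorem norm_dilate_le {r : ℝ} (h0 : 0 ≤ r) (h1 : r ≤ 1) (a : ℕ → ℂ) (n : ℕ) :
    ‖dilate r a n‖ ≤ ‖a n‖ :=
  norm_coeff_mul_pow_le (by simpa [abs_of_nonneg h0] using h1) n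

theorem norm_le_of_summable_sq {a : ℕ → ℂ} (ha : Summable fun n => ‖a n‖ ^ 2) (n : ℕ) :
    ‖a n‖ ≤ √(∑' n, ‖a n‖ ^ 2) :=
  Real.le_sqrt_of_sq_le (ha.le_tsum n fun _ _ => by positivity)

theorem summable_norm_mul_pow {a : ℕ → ℂ} {C : ℝ} (ha : ∀ n, ‖a n‖ ≤ C) {z : ℂ} (hz : ‖z‖ < 1) :
    Summable fun n => ‖a n * z ^ n‖ := by
  refine Summable.of_nonneg_of_le (fun _ => norm_nonneg _) (fun n => ?_)
    ((summable_geometric_of_lt_one (norm_nonneg z) hz).mul_left C)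
  rw [norm_mul, norm_pow]
  exact mul_le_mul_of_nonneg_right (ha n) (by positivity)

theorem summable_norm_dilate {a : ℕ → ℂ} (ha : Summable fun n => ‖a n‖ ^ 2) {r : ℝ} (h0 : 0 ≤ r)
    (h1 : r < 1) : Summable fun n => ‖dilate r a n‖ :=
  summable_norm_mul_pow (norm_le_of_summable_sq ha) (by simpa [abs_of_nonneg h0] using h1)

/-- A function holomorphic in a neighbourhood of the closed unit disk has absolutely summable Taylor
coefficients. -/
theorem exists_powSum_of_differentiableOn {F : ℂ → ℂ} {R : ℝ} (hR : 1 < R)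
    (hF : DifferentiableOn ℂ F (Metric.ball 0 R)) :
    ∃ a : ℕ → ℂ, (Summable fun n => ‖a n‖) ∧ ∀ z, ‖z‖ ≤ 1 → F z = powSum a z := by
  have key : ∀ z : ℂ, ‖z‖ < R →
      HasSum (fun n => ((n.factorial : ℂ)⁻¹ * iteratedDeriv n F 0) * z ^ n) (F z) := by
    intro z hz
    have h := Complex.hasSum_taylorSeries_on_ball hF (z := z) (by simpa using hz)
    simp only [sub_zero, smul_eq_mul] at h
    have e : (fun n => ((n.factorial : ℂ)⁻¹ * iteratedDeriv n F 0) * z ^ n) =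
        fun n => (n.factorial : ℂ)⁻¹ * (z ^ n * iteratedDeriv n F 0) := by
      funext n; ring
    rwa [e]
  refine ⟨fun n => (n.factorial : ℂ)⁻¹ * iteratedDeriv n F 0, ?_, fun z hz => ?_⟩
  -- The point `1` lies inside the disk of convergence, and there the terms are the coefficients.
  · simpa using (key 1 (by simpa using hR)).summable.norm
  · exact (key z (hz.trans_lt hR)).tsum_eq.symm

/-! ### Real trigonometric approximation and majorants of the form `|exp Q|` -/

/-- A real part is unchanged by conjugation, which turns negative frequencies into positive ones.
The factor `c` is quantified so that the induction survives complex scalar multiplication. -/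
theorem exists_polynomial_re_eq_of_mem_span {T : C(AddCircle (2 * Real.pi), ℂ)}
    (hT : T ∈ Submodule.span ℂ (Set.range (fourier (T := 2 * Real.pi)))) :
    ∀ c : ℂ, ∃ Q : Polynomial ℂ, ∀ t : ℝ,
      (c * T (t : AddCircle (2 * Real.pi))).re = (Q.eval (circleMap 0 1 t)).re := by
  have hpow : ∀ (n : ℕ) (t : ℝ), circleMap 0 1 t ^ n = Complex.exp (n * t * Complex.I) := by
    intro n t
    simp only [circleMap, Complex.ofReal_one, one_mul, zero_add, ← Complex.exp_nat_mul]
    ring_nf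
  have hf : ∀ (n : ℤ) (t : ℝ), fourier (T := 2 * Real.pi) n (t : AddCircle (2 * Real.pi)) =
      Complex.exp (n * t * Complex.I) := by
    intro n t
    rw [fourier_coe_apply]
    congr 1
    have : (Real.pi : ℂ) ≠ 0 := by exact_mod_cast Real.pi_ne_zero
    push_cast
    field_simp
  induction hT using Submodule.span_induction with
  | mem x hx =>
    obtain ⟨n, rfl⟩ := hx
    intro c
    obtain ⟨k, rfl | rfl⟩ := n.eq_nat_or_neg
    · refine ⟨Polynomial.C c * Polynomial.X ^ k, fun t => ?_⟩
      simp [hf, hpow]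
    · refine ⟨Polynomial.C (starRingEnd ℂ c) * Polynomial.X ^ k, fun t => ?_⟩
      rw [hf, ← Complex.conj_re]
      simp [hpow, ← Complex.exp_conj]
  | zero => exact fun c => ⟨0, fun t => by simp⟩
  | add x y _ _ hx hy =>
    intro c
    obtain ⟨P, hP⟩ := hx c
    obtain ⟨Q, hQ⟩ := hy c
    refine ⟨P + Q, fun t => ?_⟩
    rw [ContinuousMap.add_apply, mul_add, Complex.add_re, hP, hQ, Polynomial.eval_add,
      Complex.add_re]
  | smul a x _ hx =>
    intro c
    obtain ⟨P, hP⟩ := hx (c * a)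
    refine ⟨P, fun t => ?_⟩
    rw [← hP, ContinuousMap.smul_apply, smul_eq_mul, mul_assoc]

/-- A continuous real function on the circle is a uniform limit of real parts of polynomials. -/
theorem exists_polynomial_re_approx {u : ℂ → ℝ} (hu : ContinuousOn u (Metric.sphere 0 1)) {ε : ℝ}
    (hε : 0 < ε) :
    ∃ Q : Polynomial ℂ, ∀ z : ℂ, ‖z‖ = 1 → |(Q.eval z).re - u z| < ε := by
  have : Fact (0 < 2 * Real.pi) := ⟨Real.two_pi_pos⟩
  have hc : Continuous fun t : AddCircle (2 * Real.pi) => ((u (t.toCircle : ℂ) : ℝ) : ℂ) := by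
    refine Complex.continuous_ofReal.comp (hu.comp_continuous ?_ fun t =>
      mem_sphere_zero_iff_norm.mpr (Circle.norm_coe _))
    exact continuous_induced_dom.comp AddCircle.continuous_toCircle
  let U : C(AddCircle (2 * Real.pi), ℂ) := ⟨_, hc⟩
  have hU : U ∈ (Submodule.span ℂ (Set.range (fourier (T := 2 * Real.pi)))).topologicalClosure := by
    rw [span_fourier_closure_eq_top]; trivial
  obtain ⟨T, hT, hd⟩ := Metric.mem_closure_iff.mp hU ε hε
  obtain ⟨Q, hQ⟩ := exists_polynomial_re_eq_of_mem_span hT 1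
  refine ⟨Q, fun z hz => ?_⟩
  have hz' : z = circleMap 0 1 z.arg := by
    simpa [circleMap, hz] using (Complex.norm_mul_exp_arg_mul_I z).symm
  have h1 : U (z.arg : AddCircle (2 * Real.pi)) = (u z : ℂ) := by
    change ((u _ : ℝ) : ℂ) = _
    congr 2
    rw [AddCircle.toCircle_apply_mk, Circle.coe_exp]
    conv_rhs => rw [hz']
    simp [circleMap]
  have h2 : (Q.eval z).re - u z = (T (z.arg : AddCircle (2 * Real.pi)) -
      U (z.arg : AddCircle (2 * Real.pi))).re := by
    rw [Complex.sub_re, h1, Complex.ofReal_re]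
    conv_lhs => rw [hz']
    rw [← hQ, one_mul, ← hz']
  rw [h2]
  refine (Complex.abs_re_le_norm _).trans_lt ?_
  rw [← dist_eq_norm, dist_comm]
  exact (ContinuousMap.dist_apply_le_dist _).trans_lt hd

/-- On the circle, the modulus of a function `G` that is holomorphic on the disk and continuous on
its closure can be approximated from above by `|exp Q|` with `Q` a polynomial; then `|exp Q|` is a
majorant of `|G|` on the whole disk. -/
theorem exists_exp_polynomial_majorant {G : ℂ → ℂ} (hG : DiffContOnCl ℂ G (Metric.ball 0 1)) {ε : ℝ}
    (hε : 0 < ε) :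
    ∃ Q : Polynomial ℂ, (∀ z : ℂ, ‖z‖ = 1 → ‖Complex.exp (Q.eval z)‖ ≤ ‖G z‖ + ε) ∧
      ∀ z : ℂ, ‖z‖ ≤ 1 → ‖G z‖ ≤ ‖Complex.exp (Q.eval z)‖ := by
  have hGc : ContinuousOn G (Metric.closedBall 0 1) := hG.continuousOn_ball
  have hGs : ContinuousOn G (Metric.sphere 0 1) := hGc.mono Metric.sphere_subset_closedBall
  obtain ⟨M, hM⟩ := (isCompact_sphere (0 : ℂ) 1).exists_bound_of_continuousOn hGs
  have hM0 : 0 ≤ M := (norm_nonneg _).trans (hM 1 (by simp))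
  -- `δ` is chosen so that `exp (2 * δ) * (M + ε / 2) ≤ M + ε`
  obtain ⟨δ, hδ, hδ'⟩ : ∃ δ : ℝ, 0 < δ ∧ Real.exp (2 * δ) * (M + ε / 2) ≤ M + ε := by
    refine ⟨Real.log ((M + ε) / (M + ε / 2)) / 2, ?_, ?_⟩
    · refine half_pos (Real.log_pos ?_)
      rw [one_lt_div (by positivity)]
      linarith
    · rw [mul_div_cancel₀ _ two_ne_zero, Real.exp_log (by positivity),
        div_mul_cancel₀ _ (by positivity)]
  -- The `ε / 2` keeps the logarithm finite at zeros of `G`; raising by `δ` makes a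
  -- `δ`-approximation stay above.
  have hlog : ContinuousOn (fun z => Real.log (‖G z‖ + ε / 2) + δ) (Metric.sphere 0 1) := by
    refine ContinuousOn.add (ContinuousOn.log (by fun_prop) fun z _ => ?_) continuousOn_const
    positivity
  obtain ⟨Q, hQ⟩ := exists_polynomial_re_approx hlog hδ
  have hQ1 : ∀ z : ℂ, ‖z‖ = 1 → ‖G z‖ ≤ ‖Complex.exp (Q.eval z)‖ := by
    intro z hz
    have h := abs_lt.mp (hQ z hz)
    rw [Complex.norm_exp]
    calc ‖G z‖ ≤ ‖G z‖ + ε / 2 := by linarith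
      _ = Real.exp (Real.log (‖G z‖ + ε / 2)) := (Real.exp_log (by positivity)).symm
      _ ≤ _ := Real.exp_le_exp.mpr (by linarith)
  refine ⟨Q, fun z hz => ?_, fun z hz => ?_⟩
  · have h := abs_lt.mp (hQ z hz)
    have hGM := hM z (by simpa using hz)
    have h1 : (1 : ℝ) ≤ Real.exp (2 * δ) := Real.one_le_exp (by linarith)
    rw [Complex.norm_exp]
    calc Real.exp (Q.eval z).re ≤ Real.exp (2 * δ + Real.log (‖G z‖ + ε / 2)) :=
          Real.exp_le_exp.mpr (by linarith)
      _ = Real.exp (2 * δ) * (‖G z‖ + ε / 2) := by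
          rw [Real.exp_add, Real.exp_log (by positivity)]
      _ ≤ ‖G z‖ + ε := by nlinarith
  -- This quotient has modulus at most `1` on the circle, so the maximum principle carries the bound
  -- inside.
  · have hd : DiffContOnCl ℂ (fun z => G z * Complex.exp (-Q.eval z)) (Metric.ball 0 1) := by
      refine hG.smul (Differentiable.diffContOnCl ?_)
      exact (Q.differentiable.neg).cexp
    have h := Complex.norm_le_of_forall_mem_frontier_norm_le Metric.isBounded_ball hd (C := 1) ?_
      (z := z) (by rw [closure_ball _ one_ne_zero]; simpa using hz)
    · rw [Complex.exp_neg, norm_mul, norm_inv, ← div_eq_mul_inv,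
        div_le_one (norm_pos_iff.mpr (Complex.exp_ne_zero _))] at h
      exact h
    · intro w hw
      rw [frontier_ball _ one_ne_zero] at hw
      rw [Complex.exp_neg, norm_mul, norm_inv, ← div_eq_mul_inv,
        div_le_one (norm_pos_iff.mpr (Complex.exp_ne_zero _))]
      exact hQ1 w (by simpa using hw)

/-! ### Integral means and their monotonicity -/

/-- The integral mean of order `p` over the circle of radius `r`, with values in `[0, ∞]`. -/
def circleNorm (p r : ℝ) (F : ℂ → ℂ) : ENNReal :=
  eLpNorm (fun θ => F (circleMap 0 r θ)) (ENNReal.ofReal p) circleMeasure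

theorem eLpNorm_le_rpow_of_norm_le {α : Type*} [MeasurableSpace α] {μ : Measure α} {p : ℝ}
    (hp : 0 < p) {u v : α → ℂ} (h : ∀ x, ‖u x‖ ≤ ‖v x‖ ^ (2 / p)) :
    eLpNorm u (ENNReal.ofReal p) μ ≤ eLpNorm v 2 μ ^ (2 / p) := by
  have e : ENNReal.ofReal p * ENNReal.ofReal (2 / p) = 2 := by
    rw [← ENNReal.ofReal_mul hp.le, mul_div_cancel₀ _ hp.ne']
    simp
  have key := eLpNorm_norm_rpow (μ := μ) (p := ENNReal.ofReal p) v (q := 2 / p) (by positivity)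
  rw [e] at key
  rw [← key]
  exact eLpNorm_mono_real h

theorem eLpNorm_le_rpow_of_rpow_norm_le {α : Type*} [MeasurableSpace α] {μ : Measure α} {p : ℝ}
    (hp : 0 < p) {u v : α → ℂ} (h : ∀ x, ‖u x‖ ≤ ‖v x‖ ^ (p / 2)) :
    eLpNorm u 2 μ ≤ eLpNorm v (ENNReal.ofReal p) μ ^ (p / 2) := by
  have e : 2 * ENNReal.ofReal (p / 2) = ENNReal.ofReal p := by
    rw [show (2 : ENNReal) = ENNReal.ofReal 2 by simp, ← ENNReal.ofReal_mul zero_le_two,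
      mul_div_cancel₀ _ two_ne_zero]
  have key := eLpNorm_norm_rpow (μ := μ) (p := 2) v (q := p / 2) (by positivity)
  rw [e] at key
  rw [← key]
  exact eLpNorm_mono_real h

theorem norm_exp_real_mul (c : ℝ) (w : ℂ) :
    ‖Complex.exp (c * w)‖ = ‖Complex.exp w‖ ^ c := by
  rw [Complex.norm_exp, Complex.norm_exp, ← Real.exp_mul, Complex.re_ofReal_mul, mul_comm]

theorem norm_exp_eq_rpow {p : ℝ} (hp : 0 < p) (w : ℂ) :
    ‖Complex.exp w‖ = ‖Complex.exp ((p / 2 : ℝ) * w)‖ ^ (2 / p) := by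
  rw [norm_exp_real_mul, ← Real.rpow_mul (norm_nonneg _)]
  rw [div_mul_div_cancel₀ two_ne_zero, div_self hp.ne', Real.rpow_one]

theorem continuous_comp_circleMap {G : ℂ → ℂ} (hG : DiffContOnCl ℂ G (Metric.ball 0 1)) {s : ℝ}
    (hs : 0 ≤ s) (hs1 : s ≤ 1) : Continuous fun θ => G (circleMap 0 s θ) :=
  hG.continuousOn_ball.comp_continuous (continuous_circleMap 0 s) fun θ => by
    simpa [abs_of_nonneg hs] using hs1

/-- Dilation by `s ≤ 1` shrinks every Taylor coefficient, and Parseval reads the `L²` norm off the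
coefficients. -/
theorem eLpNorm_two_circleMap_le {h : ℂ → ℂ} (hh : Differentiable ℂ h) {s : ℝ} (hs : 0 ≤ s)
    (hs1 : s ≤ 1) :
    eLpNorm (fun θ => h (circleMap 0 s θ)) 2 circleMeasure ≤
      eLpNorm (fun θ => h (circleMap 0 1 θ)) 2 circleMeasure := by
  obtain ⟨a, ha, hha⟩ := exists_powSum_of_differentiableOn one_lt_two
    (hh.differentiableOn (s := Metric.ball 0 2))
  have hd : Summable fun n => ‖dilate s a n‖ :=
    Summable.of_nonneg_of_le (fun _ => norm_nonneg _) (norm_dilate_le hs hs1 a) ha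
  have e1 : (fun θ => h (circleMap 0 s θ)) = fun θ => powSum (dilate s a) (circleMap 0 1 θ) := by
    funext θ
    rw [powSum_dilate, ofReal_mul_circleMap, mul_one]
    exact hha _ (by simpa [abs_of_nonneg hs] using hs1)
  have e2 : (fun θ => h (circleMap 0 1 θ)) = fun θ => powSum a (circleMap 0 1 θ) := by
    funext θ
    exact hha _ (norm_circleMap_zero_one θ).le
  rw [e1, e2, eLpNorm_powSum hd, eLpNorm_powSum ha]
  refine ENNReal.ofReal_le_ofReal (Real.sqrt_le_sqrt ?_)
  refine Summable.tsum_le_tsum (fun n => ?_) (summable_sq_of_summable_norm hd)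
    (summable_sq_of_summable_norm ha)
  gcongr
  exact norm_dilate_le hs hs1 a n

/-- A holomorphic majorant `exp Q` of `G` whose integral mean is almost that of `G`. -/
theorem exists_exp_polynomial_majorant_eLpNorm {p : ℝ} (hp : 1 ≤ p) {G : ℂ → ℂ}
    (hG : DiffContOnCl ℂ G (Metric.ball 0 1)) {ε : ℝ} (hε : 0 < ε) :
    ∃ Q : Polynomial ℂ, circleNorm p 1 (fun z => Complex.exp (Q.eval z)) ≤
        circleNorm p 1 G + ENNReal.ofReal ε ∧
      ∀ z : ℂ, ‖z‖ ≤ 1 → ‖G z‖ ≤ ‖Complex.exp (Q.eval z)‖ := by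
  obtain ⟨Q, hQ1, hQ2⟩ := exists_exp_polynomial_majorant hG hε
  refine ⟨Q, ?_, hQ2⟩
  have hGc := continuous_comp_circleMap hG zero_le_one le_rfl
  calc circleNorm p 1 (fun z => Complex.exp (Q.eval z))
      ≤ eLpNorm ((fun θ => ‖G (circleMap 0 1 θ)‖) + fun _ => ε) (ENNReal.ofReal p)
          circleMeasure :=
        eLpNorm_mono_real fun θ => hQ1 _ (norm_circleMap_zero_one θ)
    _ ≤ eLpNorm (fun θ => ‖G (circleMap 0 1 θ)‖) (ENNReal.ofReal p) circleMeasure +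
          eLpNorm (fun _ => ε) (ENNReal.ofReal p) circleMeasure :=
        eLpNorm_add_le hGc.norm.aestronglyMeasurable aestronglyMeasurable_const (by simpa using hp)
    _ = circleNorm p 1 G + ENNReal.ofReal ε := by
        rw [eLpNorm_norm, eLpNorm_const _ (by simpa using by linarith)
          (NeZero.ne circleMeasure)]
        simp [circleNorm, Real.enorm_eq_ofReal hε.le]

/-- The function `G` is replaced by its majorant `exp Q`, at the cost of `ε`; the power `exp ((p/2)
Q)` reduces the claim to the case of `L²`. -/
theorem circleNorm_le_circleNorm_one {p : ℝ} (hp : 1 ≤ p) {G : ℂ → ℂ}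
    (hG : DiffContOnCl ℂ G (Metric.ball 0 1)) {s : ℝ} (hs : 0 ≤ s) (hs1 : s ≤ 1) :
    circleNorm p s G ≤ circleNorm p 1 G := by
  have hp0 : 0 < p := by linarith
  refine ENNReal.le_of_forall_pos_le_add fun ε hε _ => ?_
  obtain ⟨Q, hQ1, hQ2⟩ := exists_exp_polynomial_majorant_eLpNorm hp hG (ε := ε) (by simpa using hε)
  rw [ENNReal.ofReal_coe_nnreal] at hQ1
  refine le_trans ?_ hQ1
  have hh : Differentiable ℂ fun z => Complex.exp ((p / 2 : ℝ) * Q.eval z) :=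
    (Q.differentiable.const_mul _).cexp
  calc circleNorm p s G
      ≤ eLpNorm (fun θ => Complex.exp ((p / 2 : ℝ) * Q.eval (circleMap 0 s θ))) 2
          circleMeasure ^ (2 / p) := by
        refine eLpNorm_le_rpow_of_norm_le hp0 fun θ => ?_
        rw [← norm_exp_eq_rpow hp0]
        exact hQ2 _ (by simpa [abs_of_nonneg hs] using hs1)
    _ ≤ eLpNorm (fun θ => Complex.exp ((p / 2 : ℝ) * Q.eval (circleMap 0 1 θ))) 2
          circleMeasure ^ (2 / p) := by
        gcongr
        exact eLpNorm_two_circleMap_le hh hs hs1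
    _ ≤ (circleNorm p 1 (fun z => Complex.exp (Q.eval z)) ^ (p / 2)) ^ (2 / p) := by
        gcongr
        exact eLpNorm_le_rpow_of_rpow_norm_le hp0 fun θ => (norm_exp_real_mul _ _).le
    _ = _ := by
        rw [← ENNReal.rpow_mul, div_mul_div_cancel₀ two_ne_zero, div_self hp0.ne',
          ENNReal.rpow_one]

theorem differentiableOn_comp_mul {F : ℂ → ℂ} (hF : DifferentiableOn ℂ F (Metric.ball 0 1)) {r : ℝ}
    (h0 : 0 < r) (h1 : r < 1) :
    1 < r⁻¹ ∧ DifferentiableOn ℂ (fun z => F (r * z)) (Metric.ball 0 r⁻¹) := by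
  refine ⟨(one_lt_inv₀ h0).mpr h1, hF.comp (by fun_prop) fun z hz => ?_⟩
  simp only [mem_ball_zero_iff, norm_mul, Complex.norm_real, Real.norm_eq_abs, abs_of_pos h0] at hz ⊢
  calc r * ‖z‖ < r * r⁻¹ := by gcongr
    _ = 1 := mul_inv_cancel₀ h0.ne'

theorem DifferentiableOn.diffContOnCl_ball_one {F : ℂ → ℂ} {R : ℝ} (hR : 1 < R)
    (hF : DifferentiableOn ℂ F (Metric.ball 0 R)) : DiffContOnCl ℂ F (Metric.ball 0 1) := by
  refine DifferentiableOn.diffContOnCl (hF.mono ?_)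
  rw [closure_ball _ one_ne_zero]
  exact Metric.closedBall_subset_ball hR

theorem circleNorm_comp_mul (p r s : ℝ) (F : ℂ → ℂ) :
    circleNorm p s (fun z => F (r * z)) = circleNorm p (r * s) F := by
  simp only [circleNorm, ofReal_mul_circleMap]

theorem circleNorm_mono {p : ℝ} (hp : 1 ≤ p) {F : ℂ → ℂ}
    (hF : DifferentiableOn ℂ F (Metric.ball 0 1)) {r R : ℝ} (h0 : 0 ≤ r) (hrR : r ≤ R)
    (hR : R < 1) : circleNorm p r F ≤ circleNorm p R F := by
  rcases eq_or_lt_of_le (h0.trans hrR) with h | h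
  · rw [le_antisymm hrR (h ▸ h0)]
  · obtain ⟨h2, h3⟩ := differentiableOn_comp_mul hF h hR
    have := circleNorm_le_circleNorm_one hp (h3.diffContOnCl_ball_one h2) (s := r / R)
      (by positivity) ((div_le_one h).mpr hrR)
    rwa [circleNorm_comp_mul, circleNorm_comp_mul, mul_one, mul_div_cancel₀ _ h.ne'] at this

/-! ### Compactness in `H²` -/

/-- Each coefficient stays in a compact disk, so all of them converge along one fixed ultrafilter,
with no diagonal extraction. Finite partial sums inherit the bound `K`, and a geometric series
dominates at each point of the disk. -/
theorem exists_l2_limit {a : ℕ → ℕ → ℂ} {K : ℝ} (ha : ∀ n, Summable fun k => ‖a n k‖)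
    (hK : ∀ n, ∑' k, ‖a n k‖ ^ 2 ≤ K) :
    ∃ b : ℕ → ℂ, (Summable fun k => ‖b k‖ ^ 2) ∧
      ∀ z : ℂ, ‖z‖ < 1 → Tendsto (fun n => powSum (a n) z) (hyperfilter ℕ) (𝓝 (powSum b z)) := by
  have hak : ∀ n k, ‖a n k‖ ≤ √K := fun n k =>
    (norm_le_of_summable_sq (summable_sq_of_summable_norm (ha n)) k).trans
      (Real.sqrt_le_sqrt (hK n))
  have hlim : ∀ k, ∃ w : ℂ, Tendsto (fun n => a n k) (hyperfilter ℕ) (𝓝 w) := by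
    intro k
    obtain ⟨w, -, hw⟩ := (isCompact_closedBall (0 : ℂ) (√K)).ultrafilter_le_nhds
      ((hyperfilter ℕ).map fun n => a n k) (tendsto_principal.mpr
        (Eventually.of_forall fun n => by simpa using hak n k))
    exact ⟨w, hw⟩
  choose b hb using hlim
  refine ⟨b, ?_, fun z hz => ?_⟩
  · refine summable_of_sum_le (c := K) (fun _ => by positivity) fun s => ?_
    refine le_of_tendsto (tendsto_finsetSum s fun k _ => ((hb k).norm.pow 2))
      (Eventually.of_forall fun n => ?_)
    exact ((summable_sq_of_summable_norm (ha n)).sum_le_tsum s fun _ _ => by positivity).trans (hK n)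
  · refine tendsto_tsum_of_dominated_convergence
      ((summable_geometric_of_lt_one (norm_nonneg z) hz).mul_left (√K))
      (fun k => (hb k).mul_const _) (Eventually.of_forall fun n k => ?_)
    rw [norm_mul, norm_pow]
    exact mul_le_mul_of_nonneg_right (hak n k) (by positivity)

theorem exists_l2_limit_of_eLpNorm_le {H : ℕ → ℂ → ℂ} {R : ℕ → ℝ} (hR : ∀ n, 1 < R n)
    (hH : ∀ n, DifferentiableOn ℂ (H n) (Metric.ball 0 (R n))) {C : ENNReal} (hC : C ≠ ⊤)
    (hHC : ∀ n, eLpNorm (fun θ => H n (circleMap 0 1 θ)) 2 circleMeasure ≤ C) :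
    ∃ b : ℕ → ℂ, (Summable fun k => ‖b k‖ ^ 2) ∧
      ∀ z : ℂ, ‖z‖ < 1 → Tendsto (fun n => H n z) (hyperfilter ℕ) (𝓝 (powSum b z)) := by
  choose a ha hHa using fun n => exists_powSum_of_differentiableOn (hR n) (hH n)
  obtain ⟨b, hb, hlim⟩ := exists_l2_limit (K := C.toReal ^ 2) ha fun n => by
    have h := hHC n
    simp only [hHa n _ (norm_circleMap_zero_one _).le] at h
    rw [eLpNorm_powSum (ha n), ENNReal.ofReal_le_iff_le_toReal hC,
      Real.sqrt_le_left ENNReal.toReal_nonneg] at h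
    exact h
  exact ⟨b, hb, fun z hz => (hlim z hz).congr fun n => (hHa n z hz.le).symm⟩

/-! ### Majorants and factorization of functions in `H^p` -/

/-- Radii increasing to `1`. -/
def radius (n : ℕ) : ℝ := 1 - 1 / ((n : ℝ) + 2)

theorem radius_pos (n : ℕ) : 0 < radius n := by
  rw [radius, sub_pos, div_lt_one (by positivity)]
  linarith [n.cast_nonneg (α := ℝ)]

theorem radius_lt_one (n : ℕ) : radius n < 1 := by
  rw [radius, sub_lt_self_iff]
  positivity

theorem tendsto_radius : Tendsto radius atTop (𝓝 1) := by
  have h : Tendsto (fun n : ℕ => 1 / (((n + 1 : ℕ) : ℝ) + 1)) atTop (𝓝 0) :=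
    (tendsto_add_atTop_iff_nat (f := fun n : ℕ => 1 / ((n : ℝ) + 1)) 1).mpr
      tendsto_one_div_add_atTop_nhds_zero_nat
  have h2 := h.const_sub 1
  rw [sub_zero] at h2
  refine h2.congr fun n => ?_
  rw [radius]
  push_cast
  ring_nf

theorem tendsto_comp_radius {F : ℂ → ℂ} (hF : DifferentiableOn ℂ F (Metric.ball 0 1)) {z : ℂ}
    (hz : ‖z‖ < 1) : Tendsto (fun n => F (radius n * z)) (hyperfilter ℕ) (𝓝 (F z)) := by
  have hc : ContinuousAt F z :=
    (hF.differentiableAt (Metric.isOpen_ball.mem_nhds (by simpa using hz))).continuousAt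
  have h : Tendsto (fun n => (radius n : ℂ) * z) atTop (𝓝 z) := by
    simpa using ((Complex.continuous_ofReal.tendsto 1).comp tendsto_radius).mul_const z
  exact (hc.tendsto.comp h).mono_left Nat.hyperfilter_le_atTop

/-- A function with bounded means of order `p` is dominated by a power of an `H²` function. -/
theorem exists_l2_majorant {p : ℝ} (hp : 1 ≤ p) {F : ℂ → ℂ}
    (hF : DifferentiableOn ℂ F (Metric.ball 0 1)) {K : ENNReal} (hK : K ≠ ⊤)
    (hFK : ∀ r, 0 < r → r < 1 → circleNorm p r F ≤ K) :
    ∃ b : ℕ → ℂ, (Summable fun k => ‖b k‖ ^ 2) ∧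
      ∀ z : ℂ, ‖z‖ < 1 → ‖F z‖ ≤ ‖powSum b z‖ ^ (2 / p) := by
  have hp0 : 0 < p := by linarith
  have hG := fun n => differentiableOn_comp_mul hF (radius_pos n) (radius_lt_one n)
  -- Only boundedness of the majorants matters, so the error is fixed at `1`; it becomes the `1` in
  -- `K + 1`.
  choose Q hQ1 hQ2 using fun n =>
    exists_exp_polynomial_majorant_eLpNorm hp ((hG n).2.diffContOnCl_ball_one (hG n).1) one_pos
  have hQK : ∀ n, circleNorm p 1 (fun z => Complex.exp ((Q n).eval z)) ≤ K + 1 := by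
    intro n
    refine (hQ1 n).trans ?_
    rw [circleNorm_comp_mul, mul_one, ENNReal.ofReal_one]
    gcongr
    exact hFK _ (radius_pos n) (radius_lt_one n)
  obtain ⟨b, hb, hlim⟩ := exists_l2_limit_of_eLpNorm_le
    (H := fun n z => Complex.exp ((p / 2 : ℝ) * (Q n).eval z)) (R := fun _ => 2)
    (C := (K + 1) ^ (p / 2)) (fun _ => one_lt_two)
    (fun n => ((Q n).differentiable.const_mul _).cexp.differentiableOn)
    (ENNReal.rpow_ne_top_of_nonneg (by positivity) (by simpa using hK)) fun n => by
      refine (eLpNorm_le_rpow_of_rpow_norm_le hp0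
        (v := fun θ => Complex.exp ((Q n).eval (circleMap 0 1 θ)))
        fun θ => (norm_exp_real_mul _ _).le).trans ?_
      gcongr
      exact hQK n
  refine ⟨b, hb, fun z hz => ?_⟩
  refine le_of_tendsto_of_tendsto (tendsto_comp_radius hF hz).norm
    ((hlim z hz).norm.rpow_const (Or.inr (by positivity))) (Eventually.of_forall fun n => ?_)
  simp only [← norm_exp_eq_rpow hp0]
  exact hQ2 n z hz.le

/-- A function with bounded means of order `1` is a product of two `H²` functions. -/
theorem exists_l2_factorization {F : ℂ → ℂ} (hF : DifferentiableOn ℂ F (Metric.ball 0 1))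
    {K : ENNReal} (hK : K ≠ ⊤) (hFK : ∀ r, 0 < r → r < 1 → circleNorm 1 r F ≤ K) :
    ∃ a b : ℕ → ℂ, (Summable fun k => ‖a k‖ ^ 2) ∧ (Summable fun k => ‖b k‖ ^ 2) ∧
      ∀ z : ℂ, ‖z‖ < 1 → F z = powSum a z * powSum b z := by
  have hG := fun n => differentiableOn_comp_mul hF (radius_pos n) (radius_lt_one n)
  choose Q hQ1 hQ2 using fun n =>
    exists_exp_polynomial_majorant_eLpNorm le_rfl ((hG n).2.diffContOnCl_ball_one (hG n).1) one_pos
  have hCtop : (K + 1) ^ (1 / 2 : ℝ) ≠ ⊤ :=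
    ENNReal.rpow_ne_top_of_nonneg (by positivity) (by simpa using hK)
  have hQK : ∀ n, eLpNorm (fun θ => Complex.exp ((1 / 2 : ℝ) * (Q n).eval (circleMap 0 1 θ))) 2
      circleMeasure ≤ (K + 1) ^ (1 / 2 : ℝ) := by
    intro n
    refine (eLpNorm_le_rpow_of_rpow_norm_le one_pos
      (v := fun θ => Complex.exp ((Q n).eval (circleMap 0 1 θ)))
      fun θ => (norm_exp_real_mul _ _).le).trans ?_
    refine ENNReal.rpow_le_rpow ((hQ1 n).trans ?_) (by positivity)
    rw [circleNorm_comp_mul, mul_one, ENNReal.ofReal_one]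
    gcongr
    exact hFK _ (radius_pos n) (radius_lt_one n)
  obtain ⟨a, ha, hlima⟩ := exists_l2_limit_of_eLpNorm_le
    (H := fun n z => Complex.exp ((1 / 2 : ℝ) * (Q n).eval z)) (R := fun _ => 2)
    (fun _ => one_lt_two)
    (fun n => ((Q n).differentiable.const_mul _).cexp.differentiableOn) hCtop hQK
  -- The cofactor of `exp (Q/2)` in the dilate is itself dominated by `exp (Q/2)` on the circle,
  -- because the dilate is dominated by `exp Q`. Both factors thus share one `L²` bound.
  obtain ⟨b, hb, hlimb⟩ := exists_l2_limit_of_eLpNorm_le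
    (H := fun n z => F (radius n * z) * Complex.exp (-((1 / 2 : ℝ) * (Q n).eval z)))
    (R := fun n => (radius n)⁻¹) (fun n => (hG n).1)
    (fun n => (hG n).2.mul ((Q n).differentiable.const_mul _).neg.cexp.differentiableOn) hCtop
    fun n => (eLpNorm_mono fun θ => by
      have h2 : Complex.exp ((Q n).eval (circleMap 0 1 θ)) =
          Complex.exp ((1 / 2 : ℝ) * (Q n).eval (circleMap 0 1 θ)) *
            Complex.exp ((1 / 2 : ℝ) * (Q n).eval (circleMap 0 1 θ)) := by
        rw [← Complex.exp_add]
        congr 1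
        push_cast
        ring
      have h3 := hQ2 n _ (norm_circleMap_zero_one θ).le
      rw [h2, norm_mul] at h3
      rw [Complex.exp_neg, norm_mul, norm_inv, ← div_eq_mul_inv,
        div_le_iff₀ (norm_pos_iff.mpr (Complex.exp_ne_zero _))]
      exact h3).trans (hQK n)
  refine ⟨a, b, ha, hb, fun z hz => ?_⟩
  refine tendsto_nhds_unique (tendsto_comp_radius hF hz)
    (((hlima z hz).mul (hlimb z hz)).congr fun n => ?_)
  rw [Complex.exp_neg, mul_comm, mul_assoc, inv_mul_cancel₀ (Complex.exp_ne_zero _), mul_one]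

/-! ### Fatou's theorem: radial limits of derivatives -/

/-- The disk automorphism `z ↦ (z + r) / (1 + r z)`, for real `r`. -/
def diskShift (r : ℝ) (z : ℂ) : ℂ := (z + r) / (1 + r * z)

theorem one_add_mul_ne_zero {r : ℝ} (h0 : 0 ≤ r) (h1 : r < 1) {z : ℂ} (hz : ‖z‖ ≤ 1) :
    1 + (r : ℂ) * z ≠ 0 := by
  intro h
  have h2 : (r : ℂ) * z = -1 := by linear_combination h
  have h3 : r * ‖z‖ = 1 := by simpa [abs_of_nonneg h0] using congrArg norm h2
  nlinarith

/-- The sign of the right side shows that `diskShift r` preserves both the disk and the circle. -/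
theorem normSq_one_add_mul_sub (r : ℝ) (z : ℂ) :
    ‖1 + (r : ℂ) * z‖ ^ 2 - ‖z + r‖ ^ 2 = (1 - r ^ 2) * (1 - ‖z‖ ^ 2) := by
  simp only [← Complex.normSq_eq_norm_sq, Complex.normSq_apply, Complex.add_re, Complex.add_im,
    Complex.one_re, Complex.one_im, Complex.re_ofReal_mul, Complex.im_ofReal_mul,
    Complex.ofReal_re, Complex.ofReal_im]
  ring

theorem norm_diskShift_lt {r : ℝ} (h0 : 0 ≤ r) (h1 : r < 1) {z : ℂ} (hz : ‖z‖ < 1) :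
    ‖diskShift r z‖ < 1 := by
  rw [diskShift, norm_div, div_lt_one (norm_pos_iff.mpr (one_add_mul_ne_zero h0 h1 hz.le))]
  refine lt_of_pow_lt_pow_left₀ 2 (norm_nonneg _) ?_
  have h := normSq_one_add_mul_sub r z
  have h2 : 0 < (1 - r ^ 2) * (1 - ‖z‖ ^ 2) :=
    mul_pos (by nlinarith) (by nlinarith [norm_nonneg z])
  linarith

theorem norm_diskShift_eq {r : ℝ} (h0 : 0 ≤ r) (h1 : r < 1) {z : ℂ} (hz : ‖z‖ = 1) :
    ‖diskShift r z‖ = 1 := by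
  rw [diskShift, norm_div, div_eq_one_iff_eq (norm_ne_zero_iff.mpr
    (one_add_mul_ne_zero h0 h1 hz.le))]
  have h := normSq_one_add_mul_sub r z
  rw [hz] at h
  exact (pow_left_inj₀ (norm_nonneg _) (norm_nonneg _) two_ne_zero).mp (by linarith)

theorem diskShift_sub_one {r : ℝ} (h0 : 0 ≤ r) (h1 : r < 1) {z : ℂ} (hz : ‖z‖ ≤ 1) :
    diskShift r z - 1 = (1 - r) * (z - 1) / (1 + r * z) := by
  rw [diskShift, div_sub_one (one_add_mul_ne_zero h0 h1 hz)]
  ring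

theorem diffContOnCl_comp_diskShift {k : ℂ → ℂ} (hk : DiffContOnCl ℂ k (Metric.ball 0 1)) {r : ℝ}
    (h0 : 0 ≤ r) (h1 : r < 1) :
    DiffContOnCl ℂ (fun z => k (diskShift r z)) (Metric.ball 0 1) := by
  refine hk.comp (DifferentiableOn.diffContOnCl fun z hz => ?_) fun z hz => ?_
  · rw [closure_ball _ one_ne_zero] at hz
    unfold diskShift
    refine DifferentiableAt.differentiableWithinAt (DifferentiableAt.div (by fun_prop) (by fun_prop)
      (one_add_mul_ne_zero h0 h1 (by simpa using hz)))
  · simpa using norm_diskShift_lt h0 h1 (by simpa using hz)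

/-- This is Cauchy's formula for the derivative of `k ∘ diskShift r` at `0`, where `diskShift r` has
derivative `1 - r ^ 2`. Cauchy's theorem permits subtracting `1` from the kernel, which then
vanishes at `z = -1`, where `diskShift r` is badly behaved as `r → 1`. -/
theorem deriv_mul_eq_circleIntegral {k : ℂ → ℂ} (hk : DiffContOnCl ℂ k (Metric.ball 0 1)) {r : ℝ}
    (h0 : 0 ≤ r) (h1 : r < 1) :
    deriv k r * (1 - r ^ 2) = (2 * Real.pi * Complex.I)⁻¹ *
      ∮ z in C(0, 1), (z ^ (-2 : ℤ) - 1) * k (diskShift r z) := by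
  have hd := diffContOnCl_comp_diskShift hk h0 h1
  have e1 := hd.deriv_eq_smul_circleIntegral one_pos
  have e2 := hd.circleIntegral_eq_zero zero_le_one
  have hφ : HasDerivAt (diskShift r) (1 - (r : ℂ) ^ 2) 0 := by
    have h := ((hasDerivAt_id (0 : ℂ)).add_const (r : ℂ)).fun_div
      (((hasDerivAt_id (0 : ℂ)).const_mul (r : ℂ)).const_add 1) (by simp)
    refine HasDerivAt.congr_deriv h ?_
    simp
    ring
  have hφ0 : diskShift r 0 = r := by simp [diskShift]
  have e3 : deriv (fun z => k (diskShift r z)) 0 = deriv k r * (1 - r ^ 2) := by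
    have hkd : HasDerivAt k (deriv k r) (diskShift r 0) := by
      rw [hφ0]
      refine (hk.differentiableAt Metric.isOpen_ball ?_).hasDerivAt
      simpa [abs_of_nonneg h0] using h1
    exact (hkd.comp 0 hφ).deriv
  have hcont : ContinuousOn (fun z => k (diskShift r z)) (Metric.sphere 0 1) :=
    hd.continuousOn_ball.mono Metric.sphere_subset_closedBall
  have hz : ContinuousOn (fun z : ℂ => z ^ (-2 : ℤ)) (Metric.sphere 0 1) := fun z hz =>
    (continuousAt_zpow₀ z _ (Or.inl (by
      rintro rfl; simp at hz))).continuousWithinAt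
  have e4 : ∀ z : ℂ, 1 / (z - 0) ^ 2 = z ^ (-2 : ℤ) := fun z => by
    rw [sub_zero, zpow_neg, one_div]
    norm_cast
  simp only [e4, smul_eq_mul] at e1
  rw [eq_inv_mul_iff_mul_eq₀ Complex.two_pi_I_ne_zero, ← e3, ← e1]
  simp only [sub_mul, one_mul]
  have hm : ContinuousOn (fun z => z ^ (-2 : ℤ) * k (diskShift r z)) (Metric.sphere 0 1) :=
    hz.mul hcont
  rw [circleIntegral.integral_sub (hm.circleIntegrable zero_le_one)
    (hcont.circleIntegrable zero_le_one), e2, sub_zero]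

/-- The zero of the kernel at `-1` cancels the denominator `1 + r z` of `diskShift r z - 1`, and the
factor `1 - r` there cancels that of `1 - r ^ 2`. The bound is therefore uniform in `r` and `z`. -/
theorem norm_kernel_mul_le {k : ℂ → ℂ} {r : ℝ} (h0 : 0 ≤ r) (h1 : r < 1) {z : ℂ} (hz : ‖z‖ = 1)
    {ε : ℝ} (hε : 0 ≤ ε) (hk : ‖k (diskShift r z)‖ ≤ ε * ‖diskShift r z - 1‖) :
    ‖(z ^ (-2 : ℤ) - 1) * k (diskShift r z) / (1 - r ^ 2)‖ ≤ 8 * ε := by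
  have hz0 : z ≠ 0 := norm_ne_zero_iff.mp (by rw [hz]; exact one_ne_zero)
  have hne := norm_pos_iff.mpr (one_add_mul_ne_zero h0 h1 hz.le)
  have e1 : ‖z ^ (-2 : ℤ) - 1‖ = ‖z - 1‖ * ‖z + 1‖ := by
    have : z ^ (-2 : ℤ) - 1 = -(z ^ (-2 : ℤ) * ((z - 1) * (z + 1))) := by
      rw [zpow_neg]
      have : z ^ (2 : ℤ) ≠ 0 := zpow_ne_zero _ hz0
      field_simp
      norm_cast
      ring
    rw [this, norm_neg, norm_mul, norm_zpow, hz, one_zpow, one_mul, norm_mul]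
  have hre : -1 ≤ z.re := by
    have := Complex.abs_re_le_norm z
    rw [hz] at this
    exact (abs_le.mp this).1
  have h1r : 1 - r ≤ ‖1 + (r : ℂ) * z‖ := by
    refine le_trans ?_ (Complex.re_le_norm _)
    simp only [Complex.add_re, Complex.one_re, Complex.re_ofReal_mul]
    nlinarith
  have h2 : ‖z + 1‖ ≤ 2 * ‖1 + (r : ℂ) * z‖ := by
    have e : z + 1 = (1 + (r : ℂ) * z) + ((1 - r : ℝ) : ℂ) * z := by push_cast; ring
    rw [e]
    refine (norm_add_le _ _).trans ?_
    rw [norm_mul, hz, Complex.norm_real, Real.norm_of_nonneg (by linarith)]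
    linarith
  have h3 : ‖z - 1‖ ≤ 2 := (norm_sub_le _ _).trans (by rw [hz]; norm_num)
  have e4 : ‖diskShift r z - 1‖ = (1 - r) * ‖z - 1‖ / ‖1 + (r : ℂ) * z‖ := by
    rw [diskShift_sub_one h0 h1 hz.le, norm_div, norm_mul]
    norm_cast
    rw [Real.norm_of_nonneg (by linarith)]
  have e5 : ‖(1 : ℂ) - r ^ 2‖ = (1 - r) * (1 + r) := by
    norm_cast
    rw [Real.norm_of_nonneg (by nlinarith)]
    ring
  rw [norm_div, norm_mul, e1, e5, div_le_iff₀ (by nlinarith)]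
  rw [e4] at hk
  calc ‖z - 1‖ * ‖z + 1‖ * ‖k (diskShift r z)‖
      ≤ 2 * (2 * ‖1 + (r : ℂ) * z‖) * (ε * ((1 - r) * 2 / ‖1 + (r : ℂ) * z‖)) := by
        refine mul_le_mul (mul_le_mul h3 h2 (norm_nonneg _) zero_le_two) (hk.trans ?_)
          (norm_nonneg _) (by positivity)
        have : 0 ≤ 1 - r := by linarith
        gcongr
    _ = 8 * ε * (1 - r) := by field_simp; ring
    _ ≤ 8 * ε * ((1 - r) * (1 + r)) := by
        have : 0 ≤ 1 - r := by linarith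
        gcongr
        nlinarith

theorem isLittleO_of_hasDerivAt_circleMap {k : ℂ → ℂ} (hk1 : k 1 = 0)
    (hk : HasDerivAt (fun t : ℝ => k (circleMap 0 1 t)) 0 0) :
    k =o[𝓝[Metric.sphere 0 1] 1] fun w => w - 1 := by
  have h1 : (fun t : ℝ => k (circleMap 0 1 t)) =o[𝓝 0] fun t : ℝ => t := by
    simpa [circleMap, hk1] using hk.isLittleO
  have harg : Tendsto Complex.arg (𝓝 1) (𝓝 0) := by
    simpa using (Complex.continuousAt_arg (x := 1) (by simp)).tendsto
  -- The argument is the imaginary part of the logarithm, which is differentiable at `1`.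
  have h2 : Complex.arg =O[𝓝 1] fun w => w - 1 := by
    have h := (Complex.hasDerivAt_log (z := 1) (by simp)).isBigO_sub
    simp only [Complex.log_one, sub_zero] at h
    refine Asymptotics.IsBigO.trans (Asymptotics.isBigO_of_le _ fun w => ?_) h
    rw [← Complex.log_im, Real.norm_eq_abs]
    exact Complex.abs_im_le_norm _
  have h3 := (h1.comp_tendsto harg).trans_isBigO h2
  refine (h3.mono nhdsWithin_le_nhds).congr' ?_ EventuallyEq.rfl
  filter_upwards [self_mem_nhdsWithin] with w hw
  have hw' : ‖w‖ = 1 := by simpa using hw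
  have : circleMap 0 1 w.arg = w := by
    simpa [circleMap, hw'] using Complex.norm_mul_exp_arg_mul_I w
  simp [this]

theorem tendsto_diskShift {z : ℂ} (hz : z ≠ -1) :
    Tendsto (fun r : ℝ => diskShift r z) (𝓝[<] 1) (𝓝 1) := by
  have h1 : 1 + ((1 : ℝ) : ℂ) * z ≠ 0 := fun h => hz (by
    rw [Complex.ofReal_one, one_mul] at h
    linear_combination h)
  have h : ContinuousAt (fun r : ℝ => diskShift r z) 1 := by
    unfold diskShift
    exact ContinuousAt.div (by fun_prop) (by fun_prop) h1
  have h2 : diskShift 1 z = 1 := by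
    rw [Complex.ofReal_one, one_mul] at h1
    rw [diskShift, Complex.ofReal_one, one_mul, add_comm, div_self h1]
  have h3 := h.tendsto.mono_left (nhdsWithin_le_nhds (s := Set.Iio 1))
  rwa [h2] at h3

/-- Dominated convergence in the integral formula: as `r → 1`, the map `diskShift r` pushes every
point of the circle except `-1` towards `1`, where `k` is `o(w - 1)`. -/
theorem tendsto_deriv_zero {k : ℂ → ℂ} (hk : DiffContOnCl ℂ k (Metric.ball 0 1)) (hk1 : k 1 = 0)
    (hkd : HasDerivAt (fun t : ℝ => k (circleMap 0 1 t)) 0 0) :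
    Tendsto (fun r : ℝ => deriv k r) (𝓝[<] 1) (𝓝 0) := by
  have hlo := isLittleO_of_hasDerivAt_circleMap hk1 hkd
  have hkc : ContinuousOn k (Metric.sphere 0 1) :=
    hk.continuousOn_ball.mono Metric.sphere_subset_closedBall
  have hnear : ∀ ε > 0, ∃ δ > 0, ∀ w : ℂ, ‖w‖ = 1 → ‖w - 1‖ < δ → ‖k w‖ ≤ ε * ‖w - 1‖ := by
    intro ε hε
    obtain ⟨δ, hδ, h⟩ := Metric.mem_nhdsWithin_iff.mp (hlo.def hε)
    exact ⟨δ, hδ, fun w hw hd => h ⟨by simpa [dist_eq_norm] using hd, by simpa using hw⟩⟩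
  -- A global linear bound, needed for domination: differentiability gives it near `1`, compactness
  -- elsewhere.
  obtain ⟨C, hC0, hC⟩ : ∃ C ≥ 0, ∀ w : ℂ, ‖w‖ = 1 → ‖k w‖ ≤ C * ‖w - 1‖ := by
    obtain ⟨δ, hδ, h⟩ := hnear 1 one_pos
    obtain ⟨M, hM⟩ := (isCompact_sphere (0 : ℂ) 1).exists_bound_of_continuousOn hkc
    have hM0 : 0 ≤ M := (norm_nonneg _).trans (hM 1 (by simp))
    refine ⟨max 1 (M / δ), by positivity, fun w hw => ?_⟩
    rcases lt_or_ge ‖w - 1‖ δ with hd | hd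
    · exact (h w hw hd).trans (by gcongr; exact le_max_left _ _)
    · calc ‖k w‖ ≤ M / δ * δ := by
            rw [div_mul_cancel₀ _ hδ.ne']; exact hM w (by simpa using hw)
        _ ≤ max 1 (M / δ) * ‖w - 1‖ := by gcongr; exact le_max_right _ _
  have hIoo : ∀ᶠ r : ℝ in 𝓝[<] 1, 0 ≤ r ∧ r < 1 := by
    filter_upwards [Ioo_mem_nhdsLT zero_lt_one] with r hr using ⟨hr.1.le, hr.2⟩
  have hlim : Tendsto (fun r : ℝ => ∫ θ in (0 : ℝ)..(2 * Real.pi), deriv (circleMap 0 1) θ •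
      ((circleMap 0 1 θ ^ (-2 : ℤ) - 1) * k (diskShift r (circleMap 0 1 θ)) / (1 - r ^ 2)))
      (𝓝[<] 1) (𝓝 (∫ _ in (0 : ℝ)..(2 * Real.pi), (0 : ℂ))) := by
    refine intervalIntegral.tendsto_integral_filter_of_dominated_convergence (fun _ => 8 * C)
      ?_ ?_ intervalIntegrable_const ?_
    · filter_upwards [hIoo] with r hr
      have h1 : Continuous fun θ => k (diskShift r (circleMap 0 1 θ)) :=
        continuous_comp_circleMap (diffContOnCl_comp_diskShift hk hr.1 hr.2) zero_le_one le_rfl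
      have h2 : Continuous fun θ => circleMap 0 1 θ ^ (-2 : ℤ) :=
        (continuous_circleMap 0 1).zpow₀ _ fun θ => Or.inl (by simp)
      have h3 : Continuous (deriv (circleMap 0 1)) := by
        rw [show deriv (circleMap 0 1) = fun θ => circleMap 0 1 θ * Complex.I from
          funext fun θ => by simp]
        fun_prop
      exact (h3.smul (((h2.sub continuous_const).mul h1).div_const _)).aestronglyMeasurable
    · filter_upwards [hIoo] with r hr
      refine Eventually.of_forall fun θ _ => ?_
      rw [norm_smul, deriv_circleMap, norm_mul, norm_circleMap_zero_one, Complex.norm_I, one_mul,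
        one_mul]
      exact norm_kernel_mul_le hr.1 hr.2 (norm_circleMap_zero_one θ) hC0
        (hC _ (norm_diskShift_eq hr.1 hr.2 (norm_circleMap_zero_one θ)))
    · refine Eventually.of_forall fun θ _ => ?_
      by_cases hz : circleMap 0 1 θ = -1
      -- The exceptional point contributes nothing, since the kernel vanishes there.
      · simp only [hz]
        norm_num
      · rw [Metric.tendsto_nhds]
        intro ε hε
        obtain ⟨δ, hδ, h⟩ := hnear (ε / 16) (by positivity)
        filter_upwards [hIoo, Metric.tendsto_nhds.mp (tendsto_diskShift hz) δ hδ] with r hr hd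
        rw [dist_eq_norm] at hd
        rw [dist_zero_right, norm_smul, deriv_circleMap, norm_mul, norm_circleMap_zero_one,
          Complex.norm_I, one_mul, one_mul]
        refine (norm_kernel_mul_le hr.1 hr.2 (norm_circleMap_zero_one θ) (by positivity)
          (h _ (norm_diskShift_eq hr.1 hr.2 (norm_circleMap_zero_one θ)) hd)).trans_lt ?_
        linarith
  have hlim2 := hlim.const_mul ((2 * Real.pi * Complex.I)⁻¹ : ℂ)
  rw [intervalIntegral.integral_zero, mul_zero] at hlim2
  refine hlim2.congr' ?_
  filter_upwards [hIoo] with r hr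
  have hne : (1 : ℂ) - r ^ 2 ≠ 0 := by
    norm_cast
    nlinarith
  rw [eq_comm, ← mul_div_cancel_right₀ (deriv k r) hne,
    deriv_mul_eq_circleIntegral hk hr.1 hr.2, circleIntegral, mul_div_assoc,
    ← intervalIntegral.integral_div]
  simp only [smul_eq_mul, mul_div_assoc]

/-- Subtracting the affine function with the same value and tangential derivative at `1` reduces to
`tendsto_deriv_zero`. The division by `I` appears because `t ↦ e^{it}` has derivative `I` at `0`. -/
theorem tendsto_deriv_of_hasDerivAt_one {g : ℂ → ℂ} (hg : DiffContOnCl ℂ g (Metric.ball 0 1))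
    {d : ℂ} (hgd : HasDerivAt (fun t : ℝ => g (circleMap 0 1 t)) d 0) :
    Tendsto (fun r : ℝ => deriv g r) (𝓝[<] 1) (𝓝 (d / Complex.I)) := by
  set α : ℂ := d / Complex.I
  have hlin : Differentiable ℂ fun z : ℂ => α * z + (g 1 - α) := by fun_prop
  have hk : DiffContOnCl ℂ (fun z => g z - (α * z + (g 1 - α))) (Metric.ball 0 1) :=
    hg.sub hlin.diffContOnCl
  have hc : HasDerivAt (fun t : ℝ => α * circleMap 0 1 t + (g 1 - α)) d 0 := by
    have h := ((hasDerivAt_circleMap 0 1 0).const_mul α).add_const (g 1 - α)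
    refine h.congr_deriv ?_
    simp [α, circleMap, mul_assoc]
  have h0 := tendsto_deriv_zero hk (by simp) (by simpa using hgd.fun_sub hc)
  have h1 := h0.add_const α
  rw [zero_add] at h1
  refine h1.congr' ?_
  filter_upwards [Ioo_mem_nhdsLT zero_lt_one] with r hr
  have hgr : DifferentiableAt ℂ g r := hg.differentiableAt Metric.isOpen_ball (by
    simpa [abs_of_pos hr.1] using hr.2)
  have hl : HasDerivAt (fun z : ℂ => α * z + (g 1 - α)) α r := by
    simpa using ((hasDerivAt_id (r : ℂ)).const_mul α).add_const (g 1 - α)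
  rw [(hgr.hasDerivAt.fun_sub hl).deriv]
  ring

/-- If the boundary function of `g` is differentiable at a point of the circle, then `g'` has a
radial limit at this point. -/
theorem exists_tendsto_deriv_of_differentiableAt {g : ℂ → ℂ}
    (hg : DiffContOnCl ℂ g (Metric.ball 0 1)) {θ : ℝ}
    (hgd : DifferentiableAt ℝ (fun t : ℝ => g (circleMap 0 1 t)) θ) :
    ∃ l, Tendsto (fun r : ℝ => deriv g (r * circleMap 0 1 θ)) (𝓝[<] 1) (𝓝 l) := by
  set e : ℂ := circleMap 0 1 θ
  have he : ‖e‖ = 1 := norm_circleMap_zero_one θ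
  have he0 : e ≠ 0 := norm_ne_zero_iff.mp (by rw [he]; exact one_ne_zero)
  have hmaps : Set.MapsTo (fun z : ℂ => e * z) (Metric.ball 0 1) (Metric.ball 0 1) := by
    intro z hz
    simpa [he] using hz
  have hg0 : DiffContOnCl ℂ (fun z => g (e * z)) (Metric.ball 0 1) :=
    hg.comp (Differentiable.diffContOnCl (by fun_prop)) hmaps
  have hmul : ∀ t : ℝ, e * circleMap 0 1 t = circleMap 0 1 (t + θ) := by
    intro t
    simp only [e, circleMap, Complex.ofReal_one, one_mul, zero_add, ← Complex.exp_add]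
    push_cast
    ring_nf
  have hd : HasDerivAt (fun t : ℝ => g (e * circleMap 0 1 t))
      (deriv (fun t : ℝ => g (circleMap 0 1 t)) θ) 0 := by
    simp only [hmul]
    have h := hgd.hasDerivAt
    rw [← zero_add θ] at h
    simpa using HasDerivAt.comp_add_const 0 θ h
  refine ⟨_, ((tendsto_deriv_of_hasDerivAt_one hg0 hd).div_const e).congr fun r => ?_⟩
  rw [deriv_comp_mul_left, smul_eq_mul, mul_div_cancel_left₀ _ he0, mul_comm]

/-! ### Radial limits of functions in `H²` -/

/-- Increments of `f` are dominated by those of the primitive of `‖f'‖`, a monotone function, whose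
variation is its total increment. -/
theorem eVariationOn_Icc_le_integral {f f' : ℝ → ℂ} (hf : ∀ x, HasDerivAt f (f' x) x)
    (hc : Continuous f') (a b : ℝ) (hab : a ≤ b) :
    eVariationOn f (Set.Icc a b) ≤ ENNReal.ofReal (∫ x in a..b, ‖f' x‖) := by
  set Φ : ℝ → ℝ := fun x => ∫ t in a..x, ‖f' t‖
  have hint : ∀ x y, IntervalIntegrable (fun t => ‖f' t‖) volume x y := fun x y =>
    hc.norm.intervalIntegrable x y
  have hΦ : ∀ x y, Φ y - Φ x = ∫ t in x..y, ‖f' t‖ := fun x y =>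
    intervalIntegral.integral_interval_sub_left (hint a y) (hint a x)
  have hmono : Monotone Φ := fun x y hxy => by
    rw [← sub_nonneg, hΦ]
    exact intervalIntegral.integral_nonneg hxy fun t _ => norm_nonneg _
  have hle : ∀ x y, x ≤ y → edist (f y) (f x) ≤ edist (Φ y) (Φ x) := by
    intro x y hxy
    rw [edist_dist, edist_dist, dist_eq_norm, Real.dist_eq, abs_of_nonneg
      (sub_nonneg.mpr (hmono hxy)), hΦ, ← intervalIntegral.integral_eq_sub_of_hasDerivAt
      (fun t _ => hf t) (hc.intervalIntegrable x y)]
    exact ENNReal.ofReal_le_ofReal (intervalIntegral.norm_integral_le_integral_norm hxy)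
  have h1 : eVariationOn f (Set.Icc a b) ≤ eVariationOn Φ (Set.Icc a b) :=
    iSup_mono fun p => Finset.sum_le_sum fun i _ => hle _ _ (p.2.2.1 i.le_succ)
  refine h1.trans ?_
  have h2 := (hmono.monotoneOn (Set.Icc a b)).eVariationOn_eq (Set.left_mem_Icc.mpr hab)
    (Set.right_mem_Icc.mpr hab)
  rw [Set.inter_self, hΦ] at h2
  exact h2.le

/-- The coefficients of the primitive of the power series with coefficients `a`. -/
def primCoeff (a : ℕ → ℂ) (n : ℕ) : ℂ := a (n - 1) / n

theorem summable_norm_primCoeff {a : ℕ → ℂ} (ha : Summable fun n => ‖a n‖ ^ 2) :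
    Summable fun n => ‖primCoeff a n‖ := by
  rw [← summable_nat_add_iff 1]
  have h1 : Summable fun n : ℕ => (1 / ((n + 1 : ℕ) : ℝ) ^ 2) :=
    (summable_nat_add_iff 1).mpr (Real.summable_one_div_nat_pow.mpr one_lt_two)
  -- The comparison is `x y ≤ x ^ 2 + y ^ 2` with `x = ‖a n‖` and `y = 1 / (n + 1)`.
  refine Summable.of_nonneg_of_le (fun _ => norm_nonneg _) (fun n => ?_) (ha.add h1)
  rw [primCoeff, Nat.add_sub_cancel, norm_div, Complex.norm_natCast, one_div, ← inv_pow,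
    div_eq_mul_inv]
  nlinarith [sq_nonneg (‖a n‖ - (((n + 1 : ℕ) : ℝ))⁻¹), sq_nonneg ‖a n‖,
    sq_nonneg (((n + 1 : ℕ) : ℝ))⁻¹]

theorem diffContOnCl_powSum {b : ℕ → ℂ} (hb : Summable fun n => ‖b n‖) :
    DiffContOnCl ℂ (powSum b) (Metric.ball 0 1) := by
  refine ⟨?_, ?_⟩
  · refine Complex.differentiableOn_tsum_of_summable_norm hb (fun n => by fun_prop)
      Metric.isOpen_ball fun n z hz => norm_coeff_mul_pow_le ?_ n
    simpa using (mem_ball_zero_iff.mp hz).le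
  · rw [closure_ball _ one_ne_zero]
    exact continuousOn_powSum hb

theorem deriv_powSum_primCoeff {a : ℕ → ℂ} (ha : Summable fun n => ‖a n‖ ^ 2) {z : ℂ}
    (hz : ‖z‖ < 1) : deriv (powSum (primCoeff a)) z = powSum a z := by
  have h := Complex.hasSum_deriv_of_summable_norm (summable_norm_primCoeff ha)
    (F := fun n z => primCoeff a n * z ^ n) (fun n => by fun_prop) Metric.isOpen_ball
    (fun n w hw => norm_coeff_mul_pow_le (mem_ball_zero_iff.mp hw).le n)
    (z := z) (mem_ball_zero_iff.mpr hz)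
  rw [← hasSum_nat_add_iff' 1] at h
  simp only [Finset.range_one, Finset.sum_singleton, pow_zero, mul_one, deriv_const,
    sub_zero] at h
  have e : ∀ n : ℕ, deriv (fun w : ℂ => primCoeff a (n + 1) * w ^ (n + 1)) z = a n * z ^ n := by
    intro n
    have : ((n : ℂ) + 1) ≠ 0 := by exact_mod_cast n.succ_ne_zero
    simp [primCoeff]
    field_simp
  simp only [e] at h
  exact h.tsum_eq.symm

/-- A partial sum of the primitive has angular derivative of modulus `|∑ a n ζ ^ n|`, whose integral
is bounded through `x ≤ 1 + x ^ 2` and Parseval. Lower semicontinuity of the variation passes the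
bound to the limit. -/
theorem boundedVariationOn_powSum_primCoeff {a : ℕ → ℂ} (ha : Summable fun n => ‖a n‖ ^ 2) :
    BoundedVariationOn (fun θ => powSum (primCoeff a) (circleMap 0 1 θ))
      (Set.Icc 0 (2 * Real.pi)) := by
  set C : ℝ := 2 * Real.pi * (1 + ∑' n, ‖a n‖ ^ 2)
  have hlim : ∀ θ ∈ Set.Icc (0 : ℝ) (2 * Real.pi), Tendsto (fun N : ℕ => ∑ n ∈ Finset.range (N + 1),
      primCoeff a n * circleMap 0 1 θ ^ n) atTop (𝓝 (powSum (primCoeff a) (circleMap 0 1 θ))) :=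
    fun θ _ => (hasSum_powSum (summable_norm_primCoeff ha)
      (norm_circleMap_zero_one θ).le).tendsto_sum_nat.comp (tendsto_add_atTop_nat 1)
  have hN : ∀ N : ℕ, eVariationOn (fun θ => ∑ n ∈ Finset.range (N + 1),
      primCoeff a n * circleMap 0 1 θ ^ n) (Set.Icc 0 (2 * Real.pi)) ≤ ENNReal.ofReal C := by
    intro N
    have hd : ∀ θ, HasDerivAt (fun θ => ∑ n ∈ Finset.range (N + 1),
        primCoeff a n * circleMap 0 1 θ ^ n)
        (circleMap 0 1 θ * Complex.I * ∑ n ∈ Finset.range N, a n * circleMap 0 1 θ ^ n) θ := by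
      intro θ
      have h := HasDerivAt.fun_sum (u := Finset.range (N + 1)) fun n _ =>
        ((hasDerivAt_circleMap 0 1 θ).fun_pow n).const_mul (primCoeff a n)
      refine h.congr_deriv ?_
      rw [Finset.sum_range_succ', Finset.mul_sum]
      simp only [Nat.cast_zero, zero_mul, mul_zero, add_zero]
      refine Finset.sum_congr rfl fun n _ => ?_
      have : ((n : ℂ) + 1) ≠ 0 := by exact_mod_cast n.succ_ne_zero
      simp only [primCoeff, Nat.add_sub_cancel]
      push_cast
      field_simp
    refine (eVariationOn_Icc_le_integral hd (by fun_prop) _ _ Real.two_pi_pos.le).trans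
      (ENNReal.ofReal_le_ofReal ?_)
    have h1 := integral_norm_sq_sum_circleMap a N
    rw [integral_circleMeasure, smul_eq_mul, inv_mul_eq_iff_eq_mul₀ Real.two_pi_pos.ne'] at h1
    calc ∫ θ in (0 : ℝ)..(2 * Real.pi),
          ‖circleMap 0 1 θ * Complex.I * ∑ n ∈ Finset.range N, a n * circleMap 0 1 θ ^ n‖
        ≤ ∫ θ in (0 : ℝ)..(2 * Real.pi),
          (1 + ‖∑ n ∈ Finset.range N, a n * circleMap 0 1 θ ^ n‖ ^ 2) := by
          refine intervalIntegral.integral_mono_on Real.two_pi_pos.le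
            (Continuous.intervalIntegrable (by fun_prop) _ _)
            (Continuous.intervalIntegrable (by fun_prop) _ _) fun θ _ => ?_
          rw [norm_mul, norm_mul, norm_circleMap_zero_one, Complex.norm_I, one_mul, one_mul]
          nlinarith [sq_nonneg (‖∑ n ∈ Finset.range N, a n * circleMap 0 1 θ ^ n‖ - 1),
            norm_nonneg (∑ n ∈ Finset.range N, a n * circleMap 0 1 θ ^ n)]
      _ = 2 * Real.pi * (1 + ∑ n ∈ Finset.range N, ‖a n‖ ^ 2) := by
          rw [intervalIntegral.integral_add (by simp)
            (Continuous.intervalIntegrable (by fun_prop) _ _), h1]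
          simp
          ring
      _ ≤ C := by
          have h2 : ∑ n ∈ Finset.range N, ‖a n‖ ^ 2 ≤ ∑' n, ‖a n‖ ^ 2 :=
            ha.sum_le_tsum _ fun _ _ => by positivity
          exact mul_le_mul_of_nonneg_left (by linarith) Real.two_pi_pos.le
  refine ne_top_of_le_ne_top (ENNReal.ofReal_ne_top (r := C)) (le_of_not_gt fun hlt => ?_)
  obtain ⟨N, h⟩ := (eVariationOn.lowerSemicontinuous_aux hlim hlt).exists
  exact (hN N).not_gt h

/-- Power series with square summable coefficients have radial limits almost everywhere. -/
theorem ae_exists_tendsto_powSum {a : ℕ → ℂ} (ha : Summable fun n => ‖a n‖ ^ 2) :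
    ∀ᵐ θ ∂circleMeasure, ∃ l, Tendsto (fun r : ℝ => powSum a (r * circleMap 0 1 θ))
      (𝓝[<] 1) (𝓝 l) := by
  have hbv := (boundedVariationOn_powSum_primCoeff ha).locallyBoundedVariationOn
  have hae := hbv.ae_differentiableWithinAt measurableSet_Icc
  refine circleMeasure_absolutelyContinuous.ae_le ?_
  -- Dropping the endpoint turns differentiability within the closed interval into
  -- differentiability.
  rw [← restrict_Ioo_eq_restrict_Ioc]
  filter_upwards [ae_restrict_of_ae_restrict_of_subset Set.Ioo_subset_Icc_self hae,
    ae_restrict_mem measurableSet_Ioo] with θ hθ hmem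
  obtain ⟨l, hl⟩ := exists_tendsto_deriv_of_differentiableAt
    (diffContOnCl_powSum (summable_norm_primCoeff ha))
    (hθ.differentiableAt (Icc_mem_nhds hmem.1 hmem.2))
  refine ⟨l, hl.congr' ?_⟩
  filter_upwards [Ioo_mem_nhdsLT zero_lt_one] with r hr
  refine deriv_powSum_primCoeff ha ?_
  rw [norm_mul, norm_circleMap_zero_one, mul_one, Complex.norm_real, Real.norm_of_nonneg hr.1.le]
  exact hr.2

/-! ### Uniform integrability of the dilates of an `H²` function -/

theorem summable_sq_truncate {a : ℕ → ℂ} (ha : Summable fun n => ‖a n‖ ^ 2) (N : ℕ) :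
    (Summable fun n => ‖if n < N then 0 else a n‖ ^ 2) := by
  refine Summable.of_nonneg_of_le (fun _ => by positivity) (fun n => ?_) ha
  split_ifs <;> simp

theorem eLpNorm_powSum_dilate_le {a : ℕ → ℂ} (ha : Summable fun n => ‖a n‖ ^ 2) {r : ℝ}
    (h0 : 0 ≤ r) (h1 : r < 1) :
    eLpNorm (fun θ => powSum (dilate r a) (circleMap 0 1 θ)) 2 circleMeasure ≤
      ENNReal.ofReal (√(∑' n, ‖a n‖ ^ 2)) := by
  have hd := summable_norm_dilate ha h0 h1
  rw [eLpNorm_powSum hd]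
  refine ENNReal.ofReal_le_ofReal (Real.sqrt_le_sqrt ?_)
  refine Summable.tsum_le_tsum (fun n => ?_) (summable_sq_of_summable_norm hd) ha
  gcongr
  exact norm_dilate_le h0 h1.le a n

/-- Uniformly in the radius, a Taylor tail is small in `L²` by Parseval, and the remaining
polynomial is bounded. -/
theorem unifIntegrable_powSum {a : ℕ → ℂ} (ha : Summable fun n => ‖a n‖ ^ 2) {r : ℕ → ℝ}
    (h0 : ∀ n, 0 ≤ r n) (h1 : ∀ n, r n < 1) :
    UnifIntegrable (fun n θ => powSum a (circleMap 0 (r n) θ)) 2 circleMeasure := by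
  intro ε hε
  -- the tail of the series is small in `L²`
  have htail : Tendsto (fun N => ∑' n, ‖if n < N then 0 else a n‖ ^ 2) atTop (𝓝 0) := by
    have h := tendsto_tsum_of_dominated_convergence (𝓕 := atTop)
      (f := fun N n => ‖if n < N then 0 else a n‖ ^ 2) (g := fun _ => 0) ha (fun n => ?_)
      (Eventually.of_forall fun N n => ?_)
    · simpa using h
    · refine tendsto_const_nhds.congr' ?_
      filter_upwards [eventually_gt_atTop n] with N hN
      simp [hN]
    · split_ifs <;> simp
  have htail2 : ∀ᶠ N in atTop, √(∑' n, ‖if n < N then 0 else a n‖ ^ 2) < ε / 2 := by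
    have h := (Real.continuous_sqrt.tendsto 0).comp htail
    rw [Real.sqrt_zero] at h
    exact h.eventually_lt_const (half_pos hε)
  obtain ⟨N, hN⟩ := htail2.exists
  set b : ℕ → ℂ := fun n => if n < N then 0 else a n
  have hb : Summable fun n => ‖b n‖ ^ 2 := summable_sq_truncate ha N
  set P : ℕ → ℝ → ℂ := fun k θ => ∑ n ∈ Finset.range N, a n * circleMap 0 (r k) θ ^ n
  set T : ℕ → ℝ → ℂ := fun k θ => powSum (dilate (r k) b) (circleMap 0 1 θ)
  set M : ℝ := ∑ n ∈ Finset.range N, ‖a n‖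
  have hM : 0 ≤ M := Finset.sum_nonneg fun _ _ => norm_nonneg _
  have hnorm : ∀ k θ, ‖circleMap 0 (r k) θ‖ < 1 := fun k θ => by
    simpa [abs_of_nonneg (h0 k)] using h1 k
  have hdecomp : ∀ k, (fun θ => powSum a (circleMap 0 (r k) θ)) = P k + T k := by
    intro k
    funext θ
    have hs := (summable_norm_mul_pow (norm_le_of_summable_sq ha) (hnorm k θ)).of_norm
    have e : T k θ = ∑' n, b n * circleMap 0 (r k) θ ^ n := by
      simp only [T, powSum_dilate, ofReal_mul_circleMap, mul_one]
      rfl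
    have hsb := (summable_norm_mul_pow (norm_le_of_summable_sq hb) (hnorm k θ)).of_norm
    rw [Pi.add_apply, e, powSum, ← hs.sum_add_tsum_nat_add N, ← hsb.sum_add_tsum_nat_add N]
    have z : ∑ n ∈ Finset.range N, b n * circleMap 0 (r k) θ ^ n = 0 :=
      Finset.sum_eq_zero fun n hn => by simp [b, Finset.mem_range.mp hn]
    rw [z, zero_add]
    simp [b, P]
  have hPc : ∀ k, Continuous (P k) := fun k => by fun_prop
  have hTc : ∀ k, Continuous (T k) := fun k =>
    continuous_powSum_circleMap (summable_norm_dilate hb (h0 k) (h1 k))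
  have hPM : ∀ k θ, ‖P k θ‖ ≤ M := fun k θ => (norm_sum_le _ _).trans
    (Finset.sum_le_sum fun n _ => norm_coeff_mul_pow_le (hnorm k θ).le n)
  -- A strict bound is required, hence `M + 1`; the constant `M` serves all radii at once.
  obtain ⟨δ, hδ, hPδ⟩ := eLpNorm_indicator_le_of_bound (μ := circleMeasure) (p := 2) (by simp)
    (half_pos hε) (M := M + 1) (f := fun _ => M) (fun _ => by
      rw [Real.norm_of_nonneg hM]; exact lt_add_one M)
  refine ⟨δ, hδ, fun k s hs hμ => ?_⟩
  beta_reduce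
  rw [hdecomp, Set.indicator_add']
  calc eLpNorm (s.indicator (P k) + s.indicator (T k)) 2 circleMeasure
      ≤ eLpNorm (s.indicator (P k)) 2 circleMeasure + eLpNorm (s.indicator (T k)) 2 circleMeasure :=
        eLpNorm_add_le ((hPc k).aestronglyMeasurable.indicator hs)
          ((hTc k).aestronglyMeasurable.indicator hs) one_le_two
    _ ≤ ENNReal.ofReal (ε / 2) + ENNReal.ofReal (ε / 2) := by
        refine add_le_add (le_trans (eLpNorm_mono fun θ => ?_) (hPδ s hs hμ)) ?_
        · by_cases hθ : θ ∈ s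
          · simpa [hθ, abs_of_nonneg hM] using hPM k θ
          · simp [hθ]
        · refine (eLpNorm_indicator_le _).trans
            ((eLpNorm_powSum_dilate_le hb (h0 k) (h1 k)).trans ?_)
          exact ENNReal.ofReal_le_ofReal hN.le
    _ = ENNReal.ofReal ε := by
        rw [← ENNReal.ofReal_add (half_pos hε).le (half_pos hε).le, add_halves]

/-! ### Boundary values of functions with bounded integral means -/

/-- `F` is holomorphic on the unit disk and its integral means of order `p` are bounded. -/
structure HasBoundedMeans (p : ℝ) (F : ℂ → ℂ) : Prop where
  differentiableOn : DifferentiableOn ℂ F (Metric.ball 0 1)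
  bounded : ∃ K : ENNReal, K ≠ ⊤ ∧ ∀ r, 0 < r → r < 1 → circleNorm p r F ≤ K

/-- The radial limit of `F` at `e^{iθ}`. -/
def radialLim (F : ℂ → ℂ) (θ : ℝ) : ℂ :=
  limUnder (𝓝[<] (1 : ℝ)) fun r : ℝ => F (r * circleMap 0 1 θ)

theorem norm_circleMap_lt_one {r : ℝ} (h0 : 0 ≤ r) (h1 : r < 1) (θ : ℝ) :
    ‖circleMap 0 r θ‖ < 1 := by
  simpa [abs_of_nonneg h0] using h1

theorem continuous_circleMap_comp {F : ℂ → ℂ} (hF : DifferentiableOn ℂ F (Metric.ball 0 1)) {r : ℝ}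
    (h0 : 0 ≤ r) (h1 : r < 1) : Continuous fun θ => F (circleMap 0 r θ) :=
  hF.continuousOn.comp_continuous (continuous_circleMap 0 r) fun θ => by
    simpa using norm_circleMap_lt_one h0 h1 θ

theorem circleNorm_one_le {p : ℝ} (hp : 1 ≤ p) {F : ℂ → ℂ}
    (hF : DifferentiableOn ℂ F (Metric.ball 0 1)) {r : ℝ} (h0 : 0 ≤ r) (h1 : r < 1) :
    circleNorm 1 r F ≤ circleNorm p r F :=
  eLpNorm_le_eLpNorm_of_exponent_le (ENNReal.ofReal_le_ofReal hp)
    (continuous_circleMap_comp hF h0 h1).aestronglyMeasurable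

/-- On a probability space means of order `p` bound those of order `1`, so `F` is a product of two
`H²` functions, each with radial limits. -/
theorem HasBoundedMeans.ae_exists_tendsto {p : ℝ} (hp : 1 ≤ p) {F : ℂ → ℂ}
    (hF : HasBoundedMeans p F) : ∀ᵐ θ ∂circleMeasure, ∃ l,
      Tendsto (fun r : ℝ => F (r * circleMap 0 1 θ)) (𝓝[<] 1) (𝓝 l) := by
  obtain ⟨K, hK, hFK⟩ := hF.bounded
  obtain ⟨a, b, ha, hb, hab⟩ := exists_l2_factorization hF.differentiableOn hK fun r h0 h1 =>
    (circleNorm_one_le hp hF.differentiableOn h0.le h1).trans (hFK r h0 h1)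
  filter_upwards [ae_exists_tendsto_powSum ha, ae_exists_tendsto_powSum hb] with θ h1 h2
  obtain ⟨l, hl⟩ := h1
  obtain ⟨m, hm⟩ := h2
  refine ⟨l * m, (hl.mul hm).congr' ?_⟩
  filter_upwards [Ioo_mem_nhdsLT zero_lt_one] with r hr
  refine (hab _ ?_).symm
  rw [ofReal_mul_circleMap, mul_one]
  exact norm_circleMap_lt_one hr.1.le hr.2 θ

theorem HasBoundedMeans.ae_tendsto_radialLim {p : ℝ} (hp : 1 ≤ p) {F : ℂ → ℂ}
    (hF : HasBoundedMeans p F) : ∀ᵐ θ ∂circleMeasure,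
      Tendsto (fun r : ℝ => F (circleMap 0 r θ)) (𝓝[<] 1) (𝓝 (radialLim F θ)) := by
  filter_upwards [hF.ae_exists_tendsto hp] with θ hθ
  have h := tendsto_nhds_limUnder hθ
  simp only [ofReal_mul_circleMap, mul_one] at h
  simpa only [radialLim, ofReal_mul_circleMap, mul_one] using h

theorem tendsto_radius_nhdsLT : Tendsto radius atTop (𝓝[<] 1) :=
  tendsto_nhdsWithin_iff.mpr ⟨tendsto_radius, Eventually.of_forall radius_lt_one⟩

theorem HasBoundedMeans.memLp_radialLim {p : ℝ} (hp : 1 ≤ p) {F : ℂ → ℂ}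
    (hF : HasBoundedMeans p F) : MemLp (radialLim F) (ENNReal.ofReal p) circleMeasure := by
  have hm : ∀ n, AEStronglyMeasurable (fun θ => F (circleMap 0 (radius n) θ)) circleMeasure :=
    fun n => (continuous_circleMap_comp hF.differentiableOn (radius_pos n).le
      (radius_lt_one n)).aestronglyMeasurable
  have hlim : ∀ᵐ θ ∂circleMeasure, Tendsto (fun n => F (circleMap 0 (radius n) θ)) atTop
      (𝓝 (radialLim F θ)) := by
    filter_upwards [hF.ae_tendsto_radialLim hp] with θ hθ using hθ.comp tendsto_radius_nhdsLT
  refine ⟨aestronglyMeasurable_of_tendsto_ae atTop hm hlim, ?_⟩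
  obtain ⟨K, hK, hFK⟩ := hF.bounded
  refine (Lp.eLpNorm_lim_le_liminf_eLpNorm hm _ hlim).trans_lt (lt_of_le_of_lt ?_ hK.lt_top)
  exact (liminf_le_limsup).trans (limsup_le_of_le (h := Eventually.of_forall fun n =>
    hFK _ (radius_pos n) (radius_lt_one n)))

theorem HasBoundedMeans.unifIntegrable {p : ℝ} (hp : 1 ≤ p) {F : ℂ → ℂ}
    (hF : HasBoundedMeans p F) {r : ℕ → ℝ} (h0 : ∀ n, 0 ≤ r n) (h1 : ∀ n, r n < 1) :
    UnifIntegrable (fun n θ => F (circleMap 0 (r n) θ)) (ENNReal.ofReal p) circleMeasure := by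
  have hp0 : 0 < p := by linarith
  obtain ⟨K, hK, hFK⟩ := hF.bounded
  obtain ⟨b, hb, hFb⟩ := exists_l2_majorant hp hF.differentiableOn hK hFK
  intro ε hε
  -- The exponent undoes the power `2 / p` of the majorant.
  obtain ⟨δ, hδ, h⟩ := unifIntegrable_powSum hb h0 h1 (ε := ε ^ (p / 2)) (by positivity)
  refine ⟨δ, hδ, fun n s hs hμ => ?_⟩
  calc eLpNorm (s.indicator fun θ => F (circleMap 0 (r n) θ)) (ENNReal.ofReal p) circleMeasure
      ≤ eLpNorm (s.indicator fun θ => powSum b (circleMap 0 (r n) θ)) 2 circleMeasure ^ (2 / p) := by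
        refine eLpNorm_le_rpow_of_norm_le hp0 fun θ => ?_
        by_cases hθ : θ ∈ s
        · simpa [hθ] using hFb _ (norm_circleMap_lt_one (h0 n) (h1 n) θ)
        · simp only [hθ, not_false_eq_true, Set.indicator_of_notMem, norm_zero]
          positivity
    _ ≤ ENNReal.ofReal (ε ^ (p / 2)) ^ (2 / p) := by
        gcongr
        exact h n s hs hμ
    _ = ENNReal.ofReal ε := by
        rw [ENNReal.ofReal_rpow_of_nonneg (by positivity) (by positivity), ← Real.rpow_mul hε.le,
          div_mul_div_cancel₀ two_ne_zero, div_self hp0.ne', Real.rpow_one]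

/-- The dilates of `F` converge in `L^p` to the boundary function. -/
theorem HasBoundedMeans.tendsto_eLpNorm_sub {p : ℝ} (hp : 1 ≤ p) {F : ℂ → ℂ}
    (hF : HasBoundedMeans p F) :
    Tendsto (fun r => eLpNorm ((fun θ => F (circleMap 0 r θ)) - radialLim F) (ENNReal.ofReal p)
      circleMeasure) (𝓝[<] 1) (𝓝 0) := by
  rw [tendsto_iff_seq_tendsto]
  intro r hr
  obtain ⟨n₀, hn₀⟩ := eventually_atTop.mp (hr.eventually (Ioo_mem_nhdsLT zero_lt_one))
  rw [← tendsto_add_atTop_iff_nat n₀]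
  have hIoo : ∀ n, r (n + n₀) ∈ Set.Ioo (0 : ℝ) 1 := fun n => hn₀ _ (Nat.le_add_left _ _)
  -- Vitali's convergence theorem; the shift by `n₀` puts every radius in `(0, 1)`.
  refine tendsto_Lp_finite_of_tendsto_ae (by simpa using hp) ENNReal.ofReal_ne_top
    (f := fun n θ => F (circleMap 0 (r (n + n₀)) θ))
    (fun n => (continuous_circleMap_comp hF.differentiableOn (hIoo n).1.le
      (hIoo n).2).aestronglyMeasurable) (hF.memLp_radialLim hp)
    (hF.unifIntegrable hp (fun n => (hIoo n).1.le) fun n => (hIoo n).2) ?_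
  filter_upwards [hF.ae_tendsto_radialLim hp] with θ hθ
  exact (hθ.comp hr).comp (tendsto_add_atTop_nat n₀)

theorem HasBoundedMeans.tendsto_circleNorm {p : ℝ} (hp : 1 ≤ p) {F : ℂ → ℂ}
    (hF : HasBoundedMeans p F) :
    Tendsto (fun r => circleNorm p r F) (𝓝[<] 1)
      (𝓝 (eLpNorm (radialLim F) (ENNReal.ofReal p) circleMeasure)) := by
  have hp1 : 1 ≤ ENNReal.ofReal p := by simpa using hp
  have hN := hF.memLp_radialLim hp
  have h := hF.tendsto_eLpNorm_sub hp
  have hlow := ENNReal.Tendsto.sub (tendsto_const_nhds (x := eLpNorm (radialLim F)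
    (ENNReal.ofReal p) circleMeasure) (f := 𝓝[<] (1 : ℝ))) h (Or.inl hN.eLpNorm_ne_top)
  have hup := (tendsto_const_nhds (x := eLpNorm (radialLim F)
    (ENNReal.ofReal p) circleMeasure) (f := 𝓝[<] (1 : ℝ))).add h
  rw [tsub_zero] at hlow
  rw [add_zero] at hup
  refine tendsto_of_tendsto_of_tendsto_of_le_of_le' hlow hup ?_ ?_
  · filter_upwards [Ioo_mem_nhdsLT zero_lt_one] with r hr
    have hm := (continuous_circleMap_comp hF.differentiableOn hr.1.le
      hr.2).aestronglyMeasurable (μ := circleMeasure)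
    rw [tsub_le_iff_right]
    have e : radialLim F = (fun θ => F (circleMap 0 r θ)) -
        ((fun θ => F (circleMap 0 r θ)) - radialLim F) := by abel
    conv_lhs => rw [e]
    exact eLpNorm_sub_le hm (hm.sub hN.1) hp1
  · filter_upwards [Ioo_mem_nhdsLT zero_lt_one] with r hr
    have hm := (continuous_circleMap_comp hF.differentiableOn hr.1.le
      hr.2).aestronglyMeasurable (μ := circleMeasure)
    have e : (fun θ => F (circleMap 0 r θ)) =
        radialLim F + ((fun θ => F (circleMap 0 r θ)) - radialLim F) := by abel
    rw [circleNorm]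
    conv_lhs => rw [e]
    exact eLpNorm_add_le hN.1 (hm.sub hN.1) hp1

theorem HasBoundedMeans.circleNorm_le {p : ℝ} (hp : 1 ≤ p) {F : ℂ → ℂ}
    (hF : HasBoundedMeans p F) {r : ℝ} (h0 : 0 ≤ r) (h1 : r < 1) :
    circleNorm p r F ≤ eLpNorm (radialLim F) (ENNReal.ofReal p) circleMeasure := by
  refine ge_of_tendsto (hF.tendsto_circleNorm hp) ?_
  filter_upwards [Ioo_mem_nhdsLT h1] with R hR
  exact circleNorm_mono hp hF.differentiableOn h0 hR.1.le hR.2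

/-! ### Pointwise bounds -/

/-- Cauchy's formula on the circle of radius `r`, which stays at distance `r - ‖w‖` from `w`. -/
theorem norm_le_mul_circleNorm_one {F : ℂ → ℂ} (hF : DifferentiableOn ℂ F (Metric.ball 0 1)) {r : ℝ}
    (h0 : 0 < r) (h1 : r < 1) {w : ℂ} (hw : ‖w‖ < r) :
    ‖F w‖ ≤ (r - ‖w‖)⁻¹ * (circleNorm 1 r F).toReal := by
  have hc := continuous_circleMap_comp hF h0.le h1
  have hsub : closure (Metric.ball (0 : ℂ) r) ⊆ Metric.ball 0 1 := by
    rw [closure_ball _ h0.ne']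
    exact Metric.closedBall_subset_ball h1
  have hC := DiffContOnCl.circleIntegral_sub_inv_smul (hF.mono hsub).diffContOnCl
    (w := w) (by simpa using hw)
  have e1 : (circleNorm 1 r F).toReal = ∫ θ, ‖F (circleMap 0 r θ)‖ ∂circleMeasure := by
    rw [circleNorm, ENNReal.ofReal_one, eLpNorm_one_eq_lintegral_enorm,
      integral_norm_eq_lintegral_enorm hc.aestronglyMeasurable]
  rw [integral_circleMeasure, smul_eq_mul] at e1
  have hd : 0 < r - ‖w‖ := by linarith
  have h2 : 2 * Real.pi * ‖F w‖ ≤ ∫ θ in (0 : ℝ)..(2 * Real.pi),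
      (r - ‖w‖)⁻¹ * ‖F (circleMap 0 r θ)‖ := by
    have e2 : 2 * Real.pi * ‖F w‖ = ‖(2 * Real.pi * Complex.I : ℂ) • F w‖ := by
      simp [abs_of_pos Real.pi_pos]
    rw [e2, ← hC, circleIntegral]
    refine intervalIntegral.norm_integral_le_of_norm_le Real.two_pi_pos.le
      (Eventually.of_forall fun θ _ => ?_) ((continuous_const.mul hc.norm).intervalIntegrable _ _)
    have h3 : r - ‖w‖ ≤ ‖circleMap 0 r θ - w‖ := by
      refine le_trans ?_ (norm_sub_norm_le _ _)
      simp [abs_of_pos h0]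
    rw [norm_smul, norm_smul, norm_inv, deriv_circleMap, norm_mul, Complex.norm_I, mul_one,
      ← mul_assoc]
    refine mul_le_mul_of_nonneg_right ?_ (norm_nonneg _)
    calc ‖circleMap 0 r θ‖ * ‖circleMap 0 r θ - w‖⁻¹ ≤ 1 * (r - ‖w‖)⁻¹ := by
          gcongr
          exact (norm_circleMap_lt_one h0.le h1 θ).le
      _ = (r - ‖w‖)⁻¹ := one_mul _
  rw [intervalIntegral.integral_const_mul] at h2
  rw [e1, ← mul_assoc, mul_comm (r - ‖w‖)⁻¹, mul_assoc, ← div_eq_inv_mul,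
    le_div_iff₀ Real.two_pi_pos, mul_comm ‖F w‖]
  exact h2

/-! ### Functions on the disk and their extensions by zero -/

theorem mem_unitDisk {z : ℂ} : z ∈ unitDisk ↔ ‖z‖ < 1 := by simp [unitDisk]

theorem extendZero_apply {Ω : Set ℂ} (f : Ω → ℂ) (z : Ω) : extendZero f z = f z :=
  Subtype.val_injective.extend_apply f 0 z

theorem extendZero_of_mem {Ω : Set ℂ} (f : Ω → ℂ) {z : ℂ} (hz : z ∈ Ω) :
    extendZero f z = f ⟨z, hz⟩ :=
  extendZero_apply f ⟨z, hz⟩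

theorem extendZero_of_notMem {Ω : Set ℂ} (f : Ω → ℂ) {z : ℂ} (hz : z ∉ Ω) :
    extendZero f z = 0 :=
  Function.extend_apply' _ _ _ fun ⟨w, hw⟩ => hz (hw ▸ w.2)

theorem extendZero_add {Ω : Set ℂ} (f g : Ω → ℂ) (z : ℂ) :
    extendZero (f + g) z = extendZero f z + extendZero g z := by
  by_cases hz : z ∈ Ω
  · simp [extendZero_of_mem _ hz]
  · simp [extendZero_of_notMem _ hz]

theorem extendZero_sub {Ω : Set ℂ} (f g : Ω → ℂ) (z : ℂ) :
    extendZero (f - g) z = extendZero f z - extendZero g z := by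
  by_cases hz : z ∈ Ω
  · simp [extendZero_of_mem _ hz]
  · simp [extendZero_of_notMem _ hz]

theorem extendZero_smul {Ω : Set ℂ} (c : ℂ) (f : Ω → ℂ) (z : ℂ) :
    extendZero (c • f) z = c * extendZero f z := by
  by_cases hz : z ∈ Ω
  · simp [extendZero_of_mem _ hz]
  · simp [extendZero_of_notMem _ hz]

theorem extendZero_shiftFun {Ω : Set ℂ} (f : Ω → ℂ) (z : ℂ) :
    extendZero (shiftFun f) z = z * extendZero f z := by
  by_cases hz : z ∈ Ω
  · simp [extendZero_of_mem _ hz, shiftFun]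
  · simp [extendZero_of_notMem _ hz]

/-! ### Membership in `H^p` as boundedness of the integral means -/

theorem integralMean_eq {p r : ℝ} (hp : 1 ≤ p) (h0 : 0 ≤ r) (h1 : r < 1) {f : unitDisk → ℂ}
    (hf : DifferentiableOn ℂ (extendZero f) (Metric.ball 0 1)) :
    integralMean p r f = (circleNorm p r (extendZero f)).toReal := by
  have hp0 : 0 < p := by linarith
  have hc := continuous_circleMap_comp hf h0 h1
  rw [circleNorm, (memLp_circleMeasure_of_continuous hc _).eLpNorm_eq_integral_rpow_norm
    (by simpa using hp0) ENNReal.ofReal_ne_top, ENNReal.toReal_ofReal hp0.le,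
    integral_circleMeasure, smul_eq_mul, ENNReal.toReal_ofReal, integralMean, one_div]
  refine Real.rpow_nonneg (mul_nonneg (by positivity) ?_) _
  exact intervalIntegral.integral_nonneg Real.two_pi_pos.le fun θ _ => by positivity

theorem circleNorm_ne_top {p r : ℝ} (h0 : 0 ≤ r) (h1 : r < 1) {F : ℂ → ℂ}
    (hF : DifferentiableOn ℂ F (Metric.ball 0 1)) : circleNorm p r F ≠ ⊤ :=
  (memLp_circleMeasure_of_continuous (continuous_circleMap_comp hF h0 h1) _).eLpNorm_ne_top

/-- Links the norm to the means: `hardyNorm p f` unfolds to the `L^p` norm of `radialLim (extendZero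
f)`. Norm identities can then be checked on interior circles. -/
theorem HasBoundedMeans.tendsto_toReal {p : ℝ} (hp : 1 ≤ p) {f : unitDisk → ℂ}
    (hf : HasBoundedMeans p (extendZero f)) :
    Tendsto (fun r => (circleNorm p r (extendZero f)).toReal) (𝓝[<] 1) (𝓝 (hardyNorm p f)) :=
  (ENNReal.tendsto_toReal (hf.memLp_radialLim hp).eLpNorm_ne_top).comp (hf.tendsto_circleNorm hp)

theorem mem_hardySpace_iff {p : ℝ} (hp : 1 ≤ p) {f : unitDisk → ℂ} :
    f ∈ hardySpace p ↔ HasBoundedMeans p (extendZero f) := by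
  constructor
  · rintro ⟨hd, L, hL⟩
    refine ⟨hd, ENNReal.ofReal (L + 1), ENNReal.ofReal_ne_top, fun r h0 h1 => ?_⟩
    -- The limit controls only radii near `1`; monotonicity of the means covers the smaller ones.
    obtain ⟨R, hRL, hrR, hR1⟩ := ((hL.eventually_le_const (lt_add_one L)).and
      (Ioo_mem_nhdsLT h1)).exists
    have hR0 : 0 ≤ R := h0.le.trans hrR.le
    refine (circleNorm_mono hp hd h0.le hrR.le hR1).trans ?_
    rw [integralMean_eq hp hR0 hR1 hd] at hRL
    exact (ENNReal.le_ofReal_iff_toReal_le (circleNorm_ne_top hR0 hR1 hd)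
      (ENNReal.toReal_nonneg.trans hRL)).mpr hRL
  · intro h
    refine ⟨h.differentiableOn, hardyNorm p f, (h.tendsto_toReal hp).congr' ?_⟩
    filter_upwards [Ioo_mem_nhdsLT zero_lt_one] with r hr
    exact (integralMean_eq hp hr.1.le hr.2 h.differentiableOn).symm

theorem HasBoundedMeans.add {p : ℝ} (hp : 1 ≤ p) {F G : ℂ → ℂ} (hF : HasBoundedMeans p F)
    (hG : HasBoundedMeans p G) : HasBoundedMeans p (fun z => F z + G z) := by
  obtain ⟨K, hK, hFK⟩ := hF.bounded
  obtain ⟨M, hM, hGM⟩ := hG.bounded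
  refine ⟨hF.differentiableOn.add hG.differentiableOn, K + M, ENNReal.add_ne_top.mpr ⟨hK, hM⟩,
    fun r h0 h1 => le_trans ?_ (add_le_add (hFK r h0 h1) (hGM r h0 h1))⟩
  exact eLpNorm_add_le (continuous_circleMap_comp hF.differentiableOn h0.le h1).aestronglyMeasurable
    (continuous_circleMap_comp hG.differentiableOn h0.le h1).aestronglyMeasurable (by simpa using hp)

theorem circleNorm_const_mul (p r : ℝ) (c : ℂ) (F : ℂ → ℂ) :
    circleNorm p r (fun z => c * F z) = ‖c‖ₑ * circleNorm p r F :=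
  eLpNorm_const_smul c (fun θ => F (circleMap 0 r θ)) _ _

theorem HasBoundedMeans.const_mul {p : ℝ} (c : ℂ) {F : ℂ → ℂ} (hF : HasBoundedMeans p F) :
    HasBoundedMeans p (fun z => c * F z) := by
  obtain ⟨K, hK, hFK⟩ := hF.bounded
  refine ⟨hF.differentiableOn.const_mul c, ‖c‖ₑ * K, ENNReal.mul_ne_top enorm_ne_top hK,
    fun r h0 h1 => ?_⟩
  rw [circleNorm_const_mul]
  gcongr
  exact hFK r h0 h1

theorem HasBoundedMeans.id_mul {p : ℝ} {F : ℂ → ℂ} (hF : HasBoundedMeans p F) :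
    HasBoundedMeans p (fun z => z * F z) := by
  obtain ⟨K, hK, hFK⟩ := hF.bounded
  refine ⟨differentiableOn_id.mul hF.differentiableOn, K, hK,
    fun r h0 h1 => le_trans (eLpNorm_mono fun θ => ?_) (hFK r h0 h1)⟩
  rw [norm_mul]
  exact mul_le_of_le_one_left (norm_nonneg _) (norm_circleMap_lt_one h0.le h1 θ).le

theorem HasBoundedMeans.congr {p : ℝ} {F G : ℂ → ℂ} (hF : HasBoundedMeans p F)
    (h : ∀ z, ‖z‖ < 1 → G z = F z) : HasBoundedMeans p G := by
  obtain ⟨K, hK, hFK⟩ := hF.bounded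
  refine ⟨hF.differentiableOn.congr fun z hz => h z (by simpa using hz), K, hK,
    fun r h0 h1 => le_of_eq_of_le ?_ (hFK r h0 h1)⟩
  simp only [circleNorm, h _ (norm_circleMap_lt_one h0.le h1 _)]

theorem hasBoundedMeans_of_diffContOnCl {p : ℝ} {F : ℂ → ℂ}
    (hF : DiffContOnCl ℂ F (Metric.ball 0 1)) : HasBoundedMeans p F := by
  obtain ⟨C, hC⟩ := (isCompact_closedBall (0 : ℂ) 1).exists_bound_of_continuousOn
    hF.continuousOn_ball
  refine ⟨hF.differentiableOn, ENNReal.ofReal C, ENNReal.ofReal_ne_top, fun r h0 h1 => ?_⟩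
  refine (eLpNorm_le_of_ae_bound (C := C) (Eventually.of_forall fun θ => hC _ ?_)).trans ?_
  · simpa using (norm_circleMap_lt_one h0.le h1 θ).le
  · simp

theorem polyFun_mem_hardySpace {p : ℝ} (hp : 1 ≤ p) (P : Polynomial ℂ) :
    polyFun unitDisk P ∈ hardySpace p := by
  rw [mem_hardySpace_iff hp]
  refine (hasBoundedMeans_of_diffContOnCl P.differentiable.diffContOnCl).congr fun z hz => ?_
  rw [extendZero_of_mem _ (mem_unitDisk.mpr hz), polyFun]

/-- The Hardy space as a linear subspace. -/
def hardySubmodule (p : ℝ) (hp : 1 ≤ p) : Submodule ℂ (unitDisk → ℂ) where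
  carrier := hardySpace p
  add_mem' {f g} hf hg := by
    rw [mem_hardySpace_iff hp] at hf hg ⊢
    exact (hf.add hp hg).congr fun z _ => extendZero_add f g z
  zero_mem' := by
    have h := polyFun_mem_hardySpace hp 0
    rwa [show polyFun unitDisk 0 = 0 from funext fun w => by simp [polyFun]] at h
  smul_mem' c f hf := by
    rw [mem_hardySpace_iff hp] at hf ⊢
    exact (hf.const_mul c).congr fun z _ => extendZero_smul c f z

theorem hasBoundedMeans_coe {p : ℝ} {hp : 1 ≤ p} (f : hardySubmodule p hp) :
    HasBoundedMeans p (extendZero (f : unitDisk → ℂ)) :=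
  (mem_hardySpace_iff hp).mp f.2

/-! ### The norm -/

theorem norm_extendZero_le {p : ℝ} {hp : 1 ≤ p} (f : hardySubmodule p hp) {w : ℂ} (hw : ‖w‖ < 1) :
    ‖extendZero (f : unitDisk → ℂ) w‖ ≤ 2 / (1 - ‖w‖) * hardyNorm p f := by
  have hF := hasBoundedMeans_coe f
  -- The midpoint between `‖w‖` and `1`, which makes `(r - ‖w‖)⁻¹` equal to `2 / (1 - ‖w‖)`.
  set r : ℝ := (1 + ‖w‖) / 2
  have h0 : 0 < r := by positivity
  have h1 : r < 1 := by simp only [r]; linarith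
  have hwr : ‖w‖ < r := by simp only [r]; linarith
  refine (norm_le_mul_circleNorm_one hF.differentiableOn h0 h1 hwr).trans ?_
  have e : (r - ‖w‖)⁻¹ = 2 / (1 - ‖w‖) := by
    rw [show r - ‖w‖ = (1 - ‖w‖) / 2 by simp only [r]; ring, inv_div]
  rw [e]
  have : 0 < 1 - ‖w‖ := by linarith
  gcongr
  exact ENNReal.toReal_mono (hF.memLp_radialLim hp).eLpNorm_ne_top
    ((circleNorm_one_le hp hF.differentiableOn h0.le h1).trans (hF.circleNorm_le hp h0.le h1))

theorem hardyNorm_nonneg (p : ℝ) (f : unitDisk → ℂ) : 0 ≤ hardyNorm p f :=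
  ENNReal.toReal_nonneg

theorem hardyNorm_smul {p : ℝ} {hp : 1 ≤ p} (c : ℂ) (f : hardySubmodule p hp) :
    hardyNorm p (c • f : hardySubmodule p hp) = ‖c‖ * hardyNorm p f := by
  refine tendsto_nhds_unique ((hasBoundedMeans_coe (c • f)).tendsto_toReal hp)
    ((((hasBoundedMeans_coe f).tendsto_toReal hp).const_mul ‖c‖).congr fun r => ?_)
  have e : extendZero ((c • f : hardySubmodule p hp) : unitDisk → ℂ) =
      fun z => c * extendZero (f : unitDisk → ℂ) z := funext fun z => extendZero_smul c (f : unitDisk → ℂ) z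
  rw [e, circleNorm_const_mul, ENNReal.toReal_mul, toReal_enorm]

theorem hardyNorm_add_le {p : ℝ} {hp : 1 ≤ p} (f g : hardySubmodule p hp) :
    hardyNorm p (f + g : hardySubmodule p hp) ≤ hardyNorm p f + hardyNorm p g := by
  have hf := hasBoundedMeans_coe f
  have hg := hasBoundedMeans_coe g
  refine le_of_tendsto_of_tendsto ((hasBoundedMeans_coe (f + g)).tendsto_toReal hp)
    ((hf.tendsto_toReal hp).add (hg.tendsto_toReal hp)) ?_
  filter_upwards [Ioo_mem_nhdsLT zero_lt_one] with r hr
  have e : extendZero ((f + g : hardySubmodule p hp) : unitDisk → ℂ) =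
      fun z => extendZero (f : unitDisk → ℂ) z + extendZero (g : unitDisk → ℂ) z :=
    funext fun z => extendZero_add (f : unitDisk → ℂ) g z
  have hft := circleNorm_ne_top (p := p) hr.1.le hr.2 hf.differentiableOn
  have hgt := circleNorm_ne_top (p := p) hr.1.le hr.2 hg.differentiableOn
  rw [e, ← ENNReal.toReal_add hft hgt]
  refine ENNReal.toReal_mono (ENNReal.add_ne_top.mpr ⟨hft, hgt⟩) ?_
  exact eLpNorm_add_le
    (continuous_circleMap_comp hf.differentiableOn hr.1.le hr.2).aestronglyMeasurable
    (continuous_circleMap_comp hg.differentiableOn hr.1.le hr.2).aestronglyMeasurable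
    (by simpa using hp)

theorem hardyNorm_le_of_circleNorm_le {p : ℝ} {hp : 1 ≤ p} (f : hardySubmodule p hp) {ε : ℝ}
    (hε : 0 ≤ ε)
    (h : ∀ r, 0 < r → r < 1 → circleNorm p r (extendZero (f : unitDisk → ℂ)) ≤ ENNReal.ofReal ε) :
    hardyNorm p f ≤ ε := by
  refine le_of_tendsto ((hasBoundedMeans_coe f).tendsto_toReal hp) ?_
  filter_upwards [Ioo_mem_nhdsLT zero_lt_one] with r hr
  exact ENNReal.toReal_le_of_le_ofReal hε (h r hr.1 hr.2)

theorem hardyNorm_core {p : ℝ} (hp : 1 ≤ p) :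
    @NormedSpace.Core ℂ (hardySubmodule p hp) _ _ _ ⟨fun f => hardyNorm p f⟩ := by
  let _ : Norm (hardySubmodule p hp) := ⟨fun f => hardyNorm p f⟩
  refine { norm_nonneg := fun f => hardyNorm_nonneg p f, norm_smul := hardyNorm_smul,
           norm_triangle := hardyNorm_add_le, norm_eq_zero_iff := fun f => ⟨fun h => ?_, ?_⟩ }
  · replace h : hardyNorm p f = 0 := h
    ext w
    have hw := norm_extendZero_le f (mem_unitDisk.mp w.2)
    rw [h, mul_zero, extendZero_apply, norm_le_zero_iff] at hw
    exact hw
  · rintro rfl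
    have h := hardyNorm_smul (0 : ℂ) (0 : hardySubmodule p hp)
    rwa [norm_zero, zero_mul, zero_smul] at h

/-! ### Completeness -/

theorem hardySubmodule_complete {p : ℝ} (hp : 1 ≤ p) (u : ℕ → hardySubmodule p hp)
    (hu : ∀ ε > 0, ∃ n₀, ∀ m ≥ n₀, ∀ n ≥ n₀, hardyNorm p (u m - u n : hardySubmodule p hp) < ε) :
    ∃ f : hardySubmodule p hp,
      Tendsto (fun n => hardyNorm p (u n - f : hardySubmodule p hp)) atTop (𝓝 0) := by
  set U : ℕ → ℂ → ℂ := fun n => extendZero (u n : unitDisk → ℂ)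
  have hsub : ∀ m n z, ‖z‖ < 1 →
      ‖U m z - U n z‖ ≤ 2 / (1 - ‖z‖) * hardyNorm p (u m - u n : hardySubmodule p hp) := by
    intro m n z hz
    have h := norm_extendZero_le (u m - u n) hz
    rwa [show extendZero ((u m - u n : hardySubmodule p hp) : unitDisk → ℂ) z = U m z - U n z from
      extendZero_sub (u m : unitDisk → ℂ) (u n) z] at h
  have hcauchy : ∀ z : unitDisk, CauchySeq fun n => U n z := by
    intro z
    have hz : 0 < 1 - ‖(z : ℂ)‖ := sub_pos.mpr (mem_unitDisk.mp z.2)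
    rw [Metric.cauchySeq_iff]
    intro ε hε
    obtain ⟨n₀, h⟩ := hu (ε * ((1 - ‖(z : ℂ)‖) / 2)) (by positivity)
    refine ⟨n₀, fun m hm n hn => ?_⟩
    rw [dist_eq_norm]
    refine (hsub m n z (mem_unitDisk.mp z.2)).trans_lt ?_
    calc 2 / (1 - ‖(z : ℂ)‖) * hardyNorm p (u m - u n : hardySubmodule p hp)
        < 2 / (1 - ‖(z : ℂ)‖) * (ε * ((1 - ‖(z : ℂ)‖) / 2)) := by
          gcongr
          exact h m hm n hn
      _ = ε := by field_simp
  choose f hf using fun z => cauchySeq_tendsto_of_complete (hcauchy z)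
  have hlim : ∀ z, ‖z‖ < 1 → Tendsto (fun n => U n z) atTop (𝓝 (extendZero f z)) := by
    intro z hz
    rw [extendZero_of_mem f (mem_unitDisk.mpr hz)]
    exact hf ⟨z, mem_unitDisk.mpr hz⟩
  have hdist : ∀ ε > 0, ∃ n₀, ∀ n ≥ n₀, ∀ z, ‖z‖ < 1 →
      ‖extendZero f z - U n z‖ ≤ 2 / (1 - ‖z‖) * ε := by
    intro ε hε
    obtain ⟨n₀, h⟩ := hu ε hε
    refine ⟨n₀, fun n hn z hz => le_of_tendsto ((hlim z hz).sub_const (U n z)).norm ?_⟩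
    filter_upwards [eventually_ge_atTop n₀] with m hm
    have : 0 < 1 - ‖z‖ := by linarith
    refine (hsub m n z hz).trans ?_
    gcongr
    exact (h m hm n hn).le
  have hdiff : DifferentiableOn ℂ (extendZero f) (Metric.ball 0 1) := by
    refine TendstoLocallyUniformlyOn.differentiableOn (F := U) (φ := atTop) ?_
      (Eventually.of_forall fun n => (hasBoundedMeans_coe (u n)).differentiableOn)
      Metric.isOpen_ball
    rw [Metric.tendstoLocallyUniformlyOn_iff]
    intro ε hε z hz
    have hz1 : 0 < 1 - ‖z‖ := sub_pos.mpr (by simpa using hz)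
    obtain ⟨n₀, h⟩ := hdist (ε * ((1 - ‖z‖) / 8)) (by positivity)
    -- On this ball `1 - ‖y‖` is at least `(1 - ‖z‖) / 2`, so the `8` above leaves `ε / 2`.
    refine ⟨Metric.ball 0 ((1 + ‖z‖) / 2), mem_nhdsWithin_of_mem_nhds
      (Metric.isOpen_ball.mem_nhds (by simp only [mem_ball_zero_iff]; linarith)), ?_⟩
    filter_upwards [eventually_ge_atTop n₀] with n hn y hy
    rw [mem_ball_zero_iff] at hy
    rw [dist_eq_norm]
    refine (h n hn y (by linarith)).trans_lt ?_
    calc 2 / (1 - ‖y‖) * (ε * ((1 - ‖z‖) / 8))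
        ≤ 2 / ((1 - ‖z‖) / 2) * (ε * ((1 - ‖z‖) / 8)) := by
          gcongr
          linarith
      _ = ε / 2 := by field_simp; norm_num
      _ < ε := by linarith
  -- Fatou's lemma as `m → ∞` on each circle; `n₀` does not depend on `r`, so the bound survives `r
  -- → 1`.
  have hclose : ∀ ε > 0, ∃ n₀, ∀ n ≥ n₀, ∀ r, 0 < r → r < 1 →
      circleNorm p r (fun z => U n z - extendZero f z) ≤ ENNReal.ofReal ε := by
    intro ε hε
    obtain ⟨n₀, h⟩ := hu ε hε
    refine ⟨n₀, fun n hn r h0 h1 => ?_⟩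
    have hcont : ∀ m, Continuous fun θ => U m (circleMap 0 r θ) := fun m =>
      continuous_circleMap_comp (hasBoundedMeans_coe (u m)).differentiableOn h0.le h1
    refine (Lp.eLpNorm_lim_le_liminf_eLpNorm
      (f := fun m θ => U n (circleMap 0 r θ) - U m (circleMap 0 r θ))
      (fun m => ((hcont n).sub (hcont m)).aestronglyMeasurable) _
      (Eventually.of_forall fun θ =>
        (hlim _ (norm_circleMap_lt_one h0.le h1 θ)).const_sub _)).trans ?_
    refine (liminf_le_limsup).trans (limsup_le_of_le (h := ?_))
    filter_upwards [eventually_ge_atTop n₀] with m hm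
    have hB := hasBoundedMeans_coe (u n - u m)
    have e : (fun θ => U n (circleMap 0 r θ) - U m (circleMap 0 r θ)) = fun θ =>
        extendZero ((u n - u m : hardySubmodule p hp) : unitDisk → ℂ) (circleMap 0 r θ) :=
      funext fun θ => (extendZero_sub (u n : unitDisk → ℂ) (u m) _).symm
    rw [e]
    refine (hB.circleNorm_le hp h0.le h1).trans ?_
    exact (ENNReal.le_ofReal_iff_toReal_le (hB.memLp_radialLim hp).eLpNorm_ne_top hε.le).mpr
      (h n hn m hm).le
  have hfmem : f ∈ hardySpace p := by
    obtain ⟨n, hn⟩ := hclose 1 one_pos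
    have hB : HasBoundedMeans p (fun z => U n z - extendZero f z) :=
      ⟨(hasBoundedMeans_coe (u n)).differentiableOn.sub hdiff, _, ENNReal.ofReal_ne_top,
        hn n le_rfl⟩
    rw [mem_hardySpace_iff hp]
    exact ((hasBoundedMeans_coe (u n)).add hp (hB.const_mul (-1))).congr fun z _ => by
      simp only [U]; ring
  let g : hardySubmodule p hp := ⟨f, hfmem⟩
  refine ⟨g, Metric.tendsto_atTop.mpr fun ε hε => ?_⟩
  obtain ⟨n₀, h⟩ := hclose (ε / 2) (half_pos hε)
  refine ⟨n₀, fun n hn => ?_⟩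
  have e : extendZero ((u n - g : hardySubmodule p hp) : unitDisk → ℂ) =
      fun z => U n z - extendZero f z :=
    funext fun z => extendZero_sub (u n : unitDisk → ℂ) f z
  have hle := hardyNorm_le_of_circleNorm_le (u n - g) (half_pos hε).le
    (fun r h0 h1 => by rw [e]; exact h n hn r h0 h1)
  rw [Real.dist_eq, sub_zero, abs_of_nonneg (hardyNorm_nonneg p _)]
  linarith

/-! ### Density of the polynomials -/

/-- The Taylor series converges absolutely and uniformly on the closed disk, so a truncation
suffices. -/
theorem exists_polynomial_near {F : ℂ → ℂ} {R : ℝ} (hR : 1 < R)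
    (hF : DifferentiableOn ℂ F (Metric.ball 0 R)) {ε : ℝ} (hε : 0 < ε) :
    ∃ P : Polynomial ℂ, ∀ z, ‖z‖ ≤ 1 → ‖F z - P.eval z‖ ≤ ε := by
  obtain ⟨a, ha, hFa⟩ := exists_powSum_of_differentiableOn hR hF
  obtain ⟨N, hN⟩ := ((tendsto_sum_nat_add fun n => ‖a n‖).eventually_lt_const hε).exists
  refine ⟨∑ n ∈ Finset.range N, Polynomial.C (a n) * Polynomial.X ^ n, fun z hz => ?_⟩
  have hs := hasSum_powSum ha hz
  have hs' := (summable_nat_add_iff N).mpr ha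
  have e : F z - (∑ n ∈ Finset.range N, Polynomial.C (a n) * Polynomial.X ^ n).eval z =
      ∑' n, a (n + N) * z ^ (n + N) := by
    rw [hFa z hz, powSum, ← hs.summable.sum_add_tsum_nat_add N]
    simp [Polynomial.eval_finsetSum]
  rw [e]
  exact (tsum_of_norm_bounded hs'.hasSum fun n => norm_coeff_mul_pow_le hz _).trans hN.le

theorem exists_polynomial_hardyNorm_sub_lt {p : ℝ} (hp : 1 ≤ p) {f : unitDisk → ℂ}
    (hf : HasBoundedMeans p (extendZero f)) {ε : ℝ} (hε : 0 < ε) :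
    ∃ P : Polynomial ℂ, hardyNorm p (f - polyFun unitDisk P) < ε := by
  set F := extendZero f
  have hp1 : 1 ≤ ENNReal.ofReal p := by simpa using hp
  obtain ⟨r, hr, h0, h1⟩ := (((hf.tendsto_eLpNorm_sub hp).eventually_lt_const
    (ENNReal.ofReal_pos.mpr (half_pos hε))).and (Ioo_mem_nhdsLT zero_lt_one)).exists
  obtain ⟨hR, hd⟩ := differentiableOn_comp_mul hf.differentiableOn h0 h1
  obtain ⟨P, hP⟩ := exists_polynomial_near hR hd (half_pos hε)
  refine ⟨P, ?_⟩
  have hFc := continuous_circleMap_comp hf.differentiableOn h0.le h1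
  have hPc : Continuous fun θ => P.eval (circleMap 0 1 θ) :=
    P.continuous.comp (continuous_circleMap 0 1)
  -- The boundary error splits into a uniform error for the dilate and the `L^p` distance from the
  -- dilate to the boundary function.
  have hae : radialLim (extendZero (f - polyFun unitDisk P)) =ᵐ[circleMeasure]
      ((fun θ => F (circleMap 0 r θ)) - fun θ => P.eval (circleMap 0 1 θ)) -
        ((fun θ => F (circleMap 0 r θ)) - radialLim F) := by
    filter_upwards [hf.ae_tendsto_radialLim hp] with θ hθ
    have hPl : Tendsto (fun s : ℝ => P.eval (circleMap 0 s θ)) (𝓝[<] 1)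
        (𝓝 (P.eval (circleMap 0 1 θ))) := by
      have : Continuous fun s : ℝ => P.eval (circleMap 0 s θ) := by
        refine P.continuous.comp ?_
        unfold circleMap
        fun_prop
      exact (this.tendsto 1).mono_left nhdsWithin_le_nhds
    have hl : radialLim (extendZero (f - polyFun unitDisk P)) θ =
        radialLim F θ - P.eval (circleMap 0 1 θ) := by
      refine Tendsto.limUnder_eq ((hθ.sub hPl).congr' ?_)
      filter_upwards [Ioo_mem_nhdsLT zero_lt_one] with s hs
      have hmem : circleMap 0 s θ ∈ unitDisk :=
        mem_unitDisk.mpr (norm_circleMap_lt_one hs.1.le hs.2 θ)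
      rw [ofReal_mul_circleMap, mul_one, extendZero_sub, extendZero_of_mem (polyFun _ P) hmem,
        polyFun]
    rw [hl]
    simp only [Pi.sub_apply]
    ring
  have hbound : eLpNorm (radialLim (extendZero (f - polyFun unitDisk P))) (ENNReal.ofReal p)
      circleMeasure < ENNReal.ofReal ε := by
    rw [eLpNorm_congr_ae hae]
    calc _ ≤ _ + _ := eLpNorm_sub_le (hFc.sub hPc).aestronglyMeasurable
          (hFc.aestronglyMeasurable.sub (hf.memLp_radialLim hp).1) hp1
      _ < ENNReal.ofReal (ε / 2) + ENNReal.ofReal (ε / 2) := by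
          refine ENNReal.add_lt_add_of_le_of_lt ?_ ?_ hr
          · exact ((memLp_circleMeasure_of_continuous (hFc.sub hPc) _).eLpNorm_ne_top)
          · refine (eLpNorm_le_of_ae_bound (C := ε / 2) (Eventually.of_forall fun θ => ?_)).trans
              (by simp)
            have h := hP _ (norm_circleMap_zero_one θ).le
            rwa [ofReal_mul_circleMap, mul_one] at h
      _ = ENNReal.ofReal ε := by
          rw [← ENNReal.ofReal_add (half_pos hε).le (half_pos hε).le, add_halves]
  exact (ENNReal.lt_ofReal_iff_toReal_lt hbound.ne_top).mp hbound

end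

theorem mainTheorem5 (p : ℝ) (hp : 1 ≤ p) :
    -- the norm `‖f‖_p = ‖f^*‖_{L^p(𝕋)}` is meaningful for every `f ∈ H^p(𝔻)`
    (∀ f ∈ hardySpace p,
      (∀ᵐ θ ∂circleMeasure, ∃ l : ℂ,
        Tendsto (fun r : ℝ => extendZero f (r * circleMap 0 1 θ)) (𝓝[<] 1) (𝓝 l)) ∧
      MemLp (fun θ : ℝ => boundaryFun f (circleMap 0 1 θ)) (ENNReal.ofReal p) circleMeasure) ∧
    -- `H^p(𝔻)` is a vector space and, with this norm, a Banach space of analytic functions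
    ∃ X : Submodule ℂ (unitDisk → ℂ),
      (X : Set (unitDisk → ℂ)) = hardySpace p ∧
      IsBanachSpaceOfAnalyticFunctions unitDisk X (fun f => hardyNorm p f) := by
  refine ⟨fun f hf => ?_, hardySubmodule p hp, rfl, ?_⟩
  · have h := (mem_hardySpace_iff hp).mp hf
    exact ⟨h.ae_exists_tendsto hp, h.memLp_radialLim hp⟩
  · exact
      { isOpen := Metric.isOpen_ball
        subset_hol := fun f hf => hf.1
        core := hardyNorm_core hp
        complete := hardySubmodule_complete hp
        poly_mem := polyFun_mem_hardySpace hp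
        poly_dense := fun f ε hε => exists_polynomial_hardyNorm_sub_lt hp (hasBoundedMeans_coe f) hε
        eval_bounded := fun w => ⟨2 / (1 - ‖(w : ℂ)‖), fun f => by
          have h := norm_extendZero_le f (mem_unitDisk.mp w.2)
          rwa [extendZero_apply] at h⟩
        shift_mem := fun f hf => (mem_hardySpace_iff hp).mpr
          (((mem_hardySpace_iff hp).mp hf).id_mul.congr fun z _ => extendZero_shiftFun f z) }
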